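/- \textbf{Setting.} Sites are $x=1,2,\dots$, and $\Lambda=\{1,\dots,L\}$. Let $(\lambda_x)_{x\ge1}$ be positive with $\lambda_x\le C$ for all $x$, and let $w_x(n)$ ($x\ge 1$, $n\ge 0$) be weights for which there are functions $w_-,w_+$ with $0<w_-(n)\le w_x(n)\le w_+(n)$ for all $x,n$ and $w_\pm(n+1)/w_\pm(n)\to1$ as $n\to\infty$. For $\phi\ge0$ put $z_x(\phi)=\sum_{n\ge0}w_x(n)(\lambda_x\phi)^n$ and, when this is finite, $\nu^x_\phi(n)=w_x(n)(\lambda_x\phi)^n/z_x(\phi)$ and $R_x(\phi)=\sum_n n\,\nu_\phi^x(n)$. For a finite set $A$ of sites let $\nu_\phi^A=\bigotimes_{x\in A}\nu_\phi^x$ on $\mathbb N^A$. For $N\ge0$ let $\pi_{\Lambda,N}$ be the canonical measure on $\{\eta\in\mathbb N^\Lambda:\sum_{x\in\Lambda}\eta_x=N\}$, i.e. the probability measure with $\pi_{\Lambda,N}(\eta)\propto\prod_{x\in\Lambda}w_x(\eta_x)\lambda_x^{\eta_x}$; for $A\subseteq\Lambda$ let $\pi^A_{\Lambda,N}$ be its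 marginal on $\mathbb N^A$. Let $H(\mu_1;\mu_2)=\sum_\omega\mu_1(\omega)\log\frac{\mu_1(\omega)}{\mu_2(\omega)}$ denote relative entropy ($=\infty$ if $\mu_1\not\ll\mu_2$). Let $\phi_c=\inf_x 1/\lambda_x$. Let $D_\phi$ be the set of $\phi\ge0$ such that $z_x(\phi)<\infty$ and $R_x(\phi)<\infty$ for all $x$ and the limit $R(\phi)=\lim_{L\to\infty}\frac1L\sum_{x\in\Lambda}R_x(\phi)$ exists and is finite. Assume $[0,\phi_c)\subseteq D_\phi$, that $\rho_c:=\lim_{\phi\nearrow\phi_c}R(\phi)<\infty$, and that $\sum_{n\ge0}n\,w_-(n)=\infty$. \textbf{Theorem.} \begin{enumerate} \item \emph{Delocalized case.} Suppose that $\lambda_x<1/\phi_c$ for all $x$, that $\phi_c\in D_\phi$ (so that the critical measure $\nu_{\phi_c}$ exists with a finite limiting density), and that $\nu_{\phi_c}$ has finite second moments, $\nu_{\phi_c}(\eta_x^2)<\infty$ for all $x$. Then for every $\rho\ge\rho_c$ $$\frac1L H\big(\pi_{\Lambda,N};\nu^\Lambda_{\phi_c}\big)\to0\qquad\text{as }L\to\infty,\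 N/L\to\rho.$$ \item \emph{Localized case.} Suppose that $\Delta=\{x:\lambda_x=1/\phi_c\}\ne\emptyset$ and that for some $\delta>0$ we have $1/\lambda_y>\phi_c+\delta$ for all $y\notin\Delta$. Then for every $\rho\ge\rho_c$ $$\frac1L H\big(\pi^{\Lambda\setminus\Delta}_{\Lambda,N};\nu^{\Lambda\setminus\Delta}_{\phi_c}\big)\to0\qquad\text{as }L\to\infty,\ N/L\to\rho,$$ and moreover $|\Delta\cap\Lambda|/L\to0$ as $L\to\infty$. \end{enumerate} -/

import Mathlib

open Filter Topology MeasureTheory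

noncomputable section

namespace Condensation

/-!
Sites are numbered `0, 1, 2, …`, and the lattice of size `L` is `Finset.range L`.
`w x n` is the stationary weight of `n` particles at site `x`, and `lam x` is the profile.
-/

/-- The unnormalised weight `w_x(n) (λ_x φ)^n`. -/
def siteWeight (w : ℕ → ℕ → ℝ) (lam : ℕ → ℝ) (φ : ℝ) (x n : ℕ) : ℝ :=
  w x n * (lam x * φ) ^ n

/-- The single-site partition function `z_x(φ) = ∑_n w_x(n) (λ_x φ)^n`. -/
def siteZ (w : ℕ → ℕ → ℝ) (lam : ℕ → ℝ) (φ : ℝ) (x : ℕ) : ℝ :=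
  ∑' n : ℕ, siteWeight w lam φ x n

/-- The single-site marginal `ν_φ^x`, a measure on occupation numbers. -/
def siteMeasure (w : ℕ → ℕ → ℝ) (lam : ℕ → ℝ) (φ : ℝ) (x : ℕ) : Measure ℕ :=
  Measure.sum fun n : ℕ =>
    ENNReal.ofReal (siteWeight w lam φ x n / siteZ w lam φ x) • Measure.dirac n

/-- The grand-canonical product measure `ν_φ^A` on configurations on the finite set `A`. -/
def grandCanonical (w : ℕ → ℕ → ℝ) (lam : ℕ → ℝ) (φ : ℝ) (A : Finset ℕ) :
    Measure (A → ℕ) :=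
  Measure.pi fun x : A => siteMeasure w lam φ x

/-- The weight `∏_{x ∈ A} w_x(η_x) λ_x^{η_x}` of a configuration on `A`. -/
def configWeight (w : ℕ → ℕ → ℝ) (lam : ℕ → ℝ) (A : Finset ℕ) (η : A → ℕ) : ℝ :=
  ∏ x : A, w x (η x) * lam x ^ η x

/-- The canonical partition function `Z_{A,N}`: the sum of the weights of all configurations
on `A` with exactly `N` particles. -/
def canonicalZ (w : ℕ → ℕ → ℝ) (lam : ℕ → ℝ) (A : Finset ℕ) (N : ℕ) : ℝ :=
  ∑ η ∈ Finset.piAntidiag (Finset.univ : Finset A) N, configWeight w lam A η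

/-- The canonical measure `π_{A,N}` on configurations on `A` with exactly `N` particles. -/
def canonical (w : ℕ → ℕ → ℝ) (lam : ℕ → ℝ) (A : Finset ℕ) (N : ℕ) : Measure (A → ℕ) :=
  ∑ η ∈ Finset.piAntidiag (Finset.univ : Finset A) N,
    ENNReal.ofReal (configWeight w lam A η / canonicalZ w lam A N) • Measure.dirac η

/-- The mean occupation number `R_x(φ)` of site `x` under `ν_φ^x`. -/
def siteDensity (w : ℕ → ℕ → ℝ) (lam : ℕ → ℝ) (φ : ℝ) (x : ℕ) : ℝ :=
  (∑' n : ℕ, (n : ℝ) * siteWeight w lam φ x n) / siteZ w lam φ x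

/-- The average density `(1/L) ∑_{x ∈ Λ} R_x(φ)` on the lattice of size `L`. -/
def avgDensity (w : ℕ → ℕ → ℝ) (lam : ℕ → ℝ) (φ : ℝ) (L : ℕ) : ℝ :=
  (∑ x ∈ Finset.range L, siteDensity w lam φ x) / L

/-- The domain `D_φ` of the limiting density: the marginals are well defined with finite mean,
and the average density has a finite limit as `L → ∞`. -/
def densityDomain (w : ℕ → ℕ → ℝ) (lam : ℕ → ℝ) : Set ℝ :=
  {φ | 0 ≤ φ ∧ (∀ x, Summable fun n : ℕ => siteWeight w lam φ x n) ∧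
    (∀ x, Summable fun n : ℕ => (n : ℝ) * siteWeight w lam φ x n) ∧
    ∃ r : ℝ, Tendsto (avgDensity w lam φ) atTop (𝓝 r)}

/-- The limiting density `R(φ)`, meaningful for `φ ∈ densityDomain w lam`. -/
def limitDensity (w : ℕ → ℕ → ℝ) (lam : ℕ → ℝ) (φ : ℝ) : ℝ :=
  limUnder atTop (avgDensity w lam φ)

/-- The critical fugacity `φ_c = inf_x 1/λ_x`. -/
def critFugacity (lam : ℕ → ℝ) : ℝ := ⨅ x : ℕ, 1 / lam x

/-- The set `Δ = {x : λ_x = 1/φ_c}`. -/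
def trapSites (lam : ℕ → ℝ) : Set ℕ := {x | lam x = 1 / critFugacity lam}

open Classical in
/-- `Δ ∩ Λ` for the lattice `Λ` of size `L`. -/
def trapPart (lam : ℕ → ℝ) (L : ℕ) : Finset ℕ :=
  (Finset.range L).filter fun x => x ∈ trapSites lam

/-- `Λ \ Δ` for the lattice `Λ` of size `L`. -/
def bulkPart (lam : ℕ → ℝ) (L : ℕ) : Finset ℕ :=
  Finset.range L \ trapPart lam L

theorem bulkPart_subset (lam : ℕ → ℝ) (L : ℕ) : bulkPart lam L ⊆ Finset.range L :=
  Finset.sdiff_subset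

/-- The marginal on `Λ \ Δ` of the canonical measure `π_{Λ,N}`, `Λ` of size `L`. -/
def canonicalBulk (w : ℕ → ℕ → ℝ) (lam : ℕ → ℝ) (L N : ℕ) :
    Measure (bulkPart lam L → ℕ) :=
  (canonical w lam (Finset.range L) N).map
    (Finset.restrict₂ (π := fun _ => ℕ) (bulkPart_subset lam L))

end Condensation

end

namespace Condensation

/-! If μ ≤ K ν for probability measures, then H(μ;ν) ≤ log K. It therefore suffices to dominate the
marginal of π_{Λ,N} on B (all of Λ, or Λ∖Δ) by e^{o(L)} times the critical product measure. For a
configuration on B, the ratio of the two masses compares the weight of its extensions to Λ with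
φ_c^N Z_{Λ,N}, so the former is bounded above and the latter below, up to factors e^{O(η)L + o(L)}
with η arbitrarily small. Throughout, r = e^{-η}.

Upper bound (`sum_configWeight_le`, `map_canonical_le`). Inserting r^N makes the sum over each site
outside B converge to at most a constant, and there are only o(L) such sites. For Δ this holds
because the divergence of ∑ n w_-(n) makes the density at trap sites blow up as φ ↗ φ_c, while the
average density stays bounded (`tendsto_card_trapPart_div`).

Lower bound (`canonicalZ_lower`). All surplus particles go to one site y with λ_y φ_c ≥ r, and the
other unused sites are left empty. Since the weights are subexponential, this costs about r^{2N}.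
There remains the critical probability that the other sites of B carry at most N particles, which
must be at least e^{-ηL}. Below φ_c the limiting density is strictly below ρ_c ≤ ρ (or zero), so a
Chernoff bound controls the excess; Jensen's inequality shows that passing from φ_c to φ_c e^{-κ}
changes the partition function by at most a factor e^{κ O(L)}. -/

/-! ### Relative entropy under domination. -/

open scoped ENNReal in
/-- If a probability measure is dominated by `K` times another one, their relative entropy is at
most `log K`. -/
theorem klDiv_le_log_of_le_smul {α : Type*} [MeasurableSpace α] {μ ν : Measure α}
    [IsProbabilityMeasure μ] [IsProbabilityMeasure ν] {K : ℝ} (hK : 0 < K)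
    (h : μ ≤ ENNReal.ofReal K • ν) :
    InformationTheory.klDiv μ ν ≤ ENNReal.ofReal (Real.log K) := by
  have hac : μ ≪ ν := (Measure.absolutelyContinuous_of_le h).trans
    (Measure.smul_absolutelyContinuous)
  have hle : μ.rnDeriv ν ≤ᵐ[ν] fun _ => ENNReal.ofReal K := by
    refine ae_le_of_forall_setLIntegral_le_of_sigmaFinite (μ.measurable_rnDeriv ν) ?_
    intro s hs _
    refine (Measure.setLIntegral_rnDeriv_le s).trans ?_
    simpa using h s
  have hint : Integrable (fun x => (μ.rnDeriv ν x).toReal) ν := Measure.integrable_toReal_rnDeriv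
  -- `klFun t` is t log t + 1 - t. The right side integrates exactly to log K, because the density
  -- has integral one.
  have hbound : ∀ᵐ x ∂ν, InformationTheory.klFun (μ.rnDeriv ν x).toReal ≤
      (μ.rnDeriv ν x).toReal * Real.log K + 1 - (μ.rnDeriv ν x).toReal := by
    filter_upwards [hle] with x hx
    rw [InformationTheory.klFun_apply]
    have hx' : (μ.rnDeriv ν x).toReal ≤ K := ENNReal.toReal_le_of_le_ofReal hK.le hx
    rcases eq_or_lt_of_le (ENNReal.toReal_nonneg (a := μ.rnDeriv ν x)) with h0 | h0
    · simp [← h0]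
    · have := mul_le_mul_of_nonneg_left (Real.log_le_log h0 hx') h0.le
      linarith
  rw [InformationTheory.klDiv_eq_lintegral_klFun_of_ac hac]
  have hint2 : Integrable (fun x => (μ.rnDeriv ν x).toReal * Real.log K + 1
      - (μ.rnDeriv ν x).toReal) ν :=
    ((hint.mul_const _).add (integrable_const 1)).sub hint
  refine (lintegral_mono_ae (hbound.mono fun x hx => ENNReal.ofReal_le_ofReal hx)).trans ?_
  rw [← ofReal_integral_eq_lintegral_ofReal hint2]
  · refine ENNReal.ofReal_le_ofReal (le_of_eq ?_)
    have e1 := integral_sub (((hint.mul_const (Real.log K)).add (integrable_const 1))) hint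
    have e2 := integral_add (hint.mul_const (Real.log K)) (integrable_const (μ := ν) (1 : ℝ))
    simp only [Pi.add_apply] at e1 e2
    rw [e1, e2, integral_mul_const,
      Measure.integral_toReal_rnDeriv hac]
    simp
  · filter_upwards [hbound] with x hx
    exact (InformationTheory.klFun_nonneg ENNReal.toReal_nonneg).trans hx

theorem measure_le_of_singleton_le {α : Type*} [MeasurableSpace α] [Countable α]
    [MeasurableSingletonClass α] {μ ν : Measure α} (h : ∀ a, μ {a} ≤ ν {a}) : μ ≤ ν := by
  refine Measure.le_iff.2 fun s _ => ?_
  rw [← Measure.tsum_indicator_apply_singleton μ s (Set.to_countable s).measurableSet,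
    ← Measure.tsum_indicator_apply_singleton ν s (Set.to_countable s).measurableSet]
  exact ENNReal.tsum_le_tsum fun a => Set.indicator_le_indicator (h a)

/-! ### Exponential tilting of weights on ℕ. -/

/-- Jensen's inequality for `n ↦ s ^ n` under the probability weights `b n / z`. -/
theorem mul_rpow_mean_le {b : ℕ → ℝ} (hb : ∀ n, 0 ≤ b n) {z S z' s : ℝ} (hs : 0 < s) (hz0 : 0 < z)
    (hz : HasSum b z) (hS : HasSum (fun n : ℕ => n * b n) S)
    (hz' : HasSum (fun n => b n * s ^ n) z') : z * s ^ (S / z) ≤ z' := by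
  have h1 : HasSum (fun n : ℕ => s ^ (S / z) * (b n + Real.log s * (n * b n - S / z * b n)))
      (s ^ (S / z) * (z + Real.log s * (S - S / z * z))) :=
    (hz.add ((hS.sub (hz.mul_left _)).mul_left _)).mul_left _
  have h2 : s ^ (S / z) * (z + Real.log s * (S - S / z * z)) = z * s ^ (S / z) := by
    field_simp; ring
  rw [h2] at h1
  refine hasSum_le (fun n => ?_) h1 hz'
  -- The tangent line of n ↦ s^n at the mean S / z; its linear part averages to zero.
  have h3 : s ^ (S / z) * (1 + Real.log s * (n - S / z)) ≤ s ^ n := by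
    have : s ^ n = s ^ (S / z) * Real.exp (Real.log s * (n - S / z)) := by
      rw [← Real.rpow_natCast, Real.rpow_def_of_pos hs, Real.rpow_def_of_pos hs, ← Real.exp_add]
      congr 1; ring
    rw [this]
    gcongr
    linarith [Real.add_one_le_exp (Real.log s * (n - S / z))]
  calc _ = b n * (s ^ (S / z) * (1 + Real.log s * (n - S / z))) := by ring
    _ ≤ _ := mul_le_mul_of_nonneg_left h3 (hb n)

/-- The mean of the tilted weights `b n * s ^ n`, `s > 1`, exceeds that of `b n` by a definite
factor. -/
theorem mean_mul_le_tilted_mean {b : ℕ → ℝ} (hb : ∀ n, 0 ≤ b n) (hb0 : 0 < b 0) (hb1 : 0 < b 1)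
    {z S z' S' s : ℝ} (hs : 1 < s)
    (hz : HasSum b z) (hS : HasSum (fun n : ℕ => n * b n) S)
    (hz' : HasSum (fun n => b n * s ^ n) z')
    (hS' : HasSum (fun n : ℕ => n * (b n * s ^ n)) S') :
    S / z * (1 + (s - 1) * b 0 / z') ≤ S' / z' := by
  have hs0 : 0 < s := by linarith
  -- Removing n = 0 factors the mean as P(n ≥ 1) times the mean given n ≥ 1. Tilting does not lower
  -- the second factor and raises the first quantitatively.
  set c : ℕ → ℝ := Function.update b 0 0 with hc
  have hc_nonneg : ∀ n, 0 ≤ c n := by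
    intro n
    rcases eq_or_ne n 0 with rfl | hn
    · simp [hc]
    · simpa [hc, hn] using hb n
  have hcn : ∀ n, n ≠ 0 → c n = b n := fun n hn => by simp [hc, hn]
  have hcz : HasSum c (z - b 0) := by
    have := hz.update 0 0
    simpa [hc, sub_eq_add_neg, add_comm] using this
  have hcz' : HasSum (fun n => c n * s ^ n) (z' - b 0) := by
    have h1 := hz'.update 0 0
    have h2 : (fun n => c n * s ^ n) = Function.update (fun n => b n * s ^ n) 0 0 := by
      funext n
      rcases eq_or_ne n 0 with rfl | hn
      · simp [hc]
      · simp [hc, hn]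
    rw [h2]
    simpa [sub_eq_add_neg, add_comm] using h1
  have hcS : HasSum (fun n : ℕ => n * c n) S := by
    convert hS using 2 with n
    rcases eq_or_ne n 0 with rfl | hn
    · simp
    · rw [hcn n hn]
  have hcS' : HasSum (fun n : ℕ => n * (c n * s ^ n)) S' := by
    convert hS' using 2 with n
    rcases eq_or_ne n 0 with rfl | hn
    · simp
    · rw [hcn n hn]
  have hu : 0 < z - b 0 := by
    have := le_hasSum hcz 1 (fun n _ => hc_nonneg n)
    rw [hcn 1 one_ne_zero] at this
    linarith
  have hv : s * (z - b 0) ≤ z' - b 0 := by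
    refine hasSum_le (fun n => ?_) (hcz.mul_left s) hcz'
    rcases eq_or_ne n 0 with rfl | hn
    · simp [hc]
    · have : s ≤ s ^ n := le_self_pow₀ hs.le hn
      nlinarith [hc_nonneg n]
  have hv0 : 0 < z' - b 0 := lt_of_lt_of_le (by positivity) hv
  have hS'0 : 0 ≤ S := hcS.nonneg fun n => mul_nonneg n.cast_nonneg (hc_nonneg n)
  -- Jensen for the tilt by s, then for the reverse tilt by 1/s, sandwiches the ratio of the two
  -- normalisations between s to the old mean and s to the new mean.
  have key : S / (z - b 0) ≤ S' / (z' - b 0) := by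
    have j1 := mul_rpow_mean_le hc_nonneg hs0 hu hcz hcS hcz'
    have j2 := mul_rpow_mean_le (fun n => mul_nonneg (hc_nonneg n) (pow_nonneg hs0.le n))
      (inv_pos.2 hs0) hv0 hcz' hcS' (z' := z - b 0) (by
        convert hcz using 2 with n
        rw [mul_assoc, ← mul_pow, mul_inv_cancel₀ hs0.ne', one_pow, mul_one])
    rw [Real.inv_rpow hs0.le, ← div_eq_mul_inv,
      div_le_iff₀ (Real.rpow_pos_of_pos hs0 _)] at j2
    have j3 := j1.trans j2
    exact (Real.rpow_le_rpow_left_iff hs).1 (le_of_mul_le_mul_left j3 hu)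
  have hz0 : 0 < z := by linarith
  have hz'0 : 0 < z' := by linarith
  have e1 : S / z = S / (z - b 0) * ((z - b 0) / z) := by field_simp
  have e2 : S' / z' = S' / (z' - b 0) * ((z' - b 0) / z') := by field_simp
  have e3 : (z - b 0) / z * (1 + (s - 1) * b 0 / z') ≤ (z' - b 0) / z' := by
    rw [show (z - b 0) / z * (1 + (s - 1) * b 0 / z') =
      ((z - b 0) * (z' + (s - 1) * b 0)) / (z * z') by field_simp, div_le_div_iff₀ (by positivity)
      hz'0]
    have : (z - b 0) * (z' + (s - 1) * b 0) ≤ (z' - b 0) * z := by nlinarith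
    nlinarith
  rw [e1, e2, mul_assoc]
  have : 0 ≤ S / (z - b 0) := by positivity
  have h5 : 0 ≤ (z' - b 0) / z' := by positivity
  exact (mul_le_mul_of_nonneg_left e3 this).trans (mul_le_mul_of_nonneg_right key h5)

/-! ### Products of power series. -/

theorem coeff_prod_nonneg {ι : Type*} (A : Finset ι) {f : ι → PowerSeries ℝ}
    (hf : ∀ x n, 0 ≤ PowerSeries.coeff n (f x)) (n : ℕ) :
    0 ≤ PowerSeries.coeff n (∏ x ∈ A, f x) := by
  classical
  rw [PowerSeries.coeff_prod]
  exact Finset.sum_nonneg fun l _ => Finset.prod_nonneg fun x _ => hf _ _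

theorem coeff_mul_coeff_le {f g : PowerSeries ℝ} (hf : ∀ n, 0 ≤ PowerSeries.coeff n f)
    (hg : ∀ n, 0 ≤ PowerSeries.coeff n g) (m n : ℕ) :
    PowerSeries.coeff m f * PowerSeries.coeff n g ≤ PowerSeries.coeff (m + n) (f * g) := by
  rw [PowerSeries.coeff_mul]
  exact Finset.single_le_sum
    (f := fun p : ℕ × ℕ => PowerSeries.coeff p.1 f * PowerSeries.coeff p.2 g)
    (fun p _ => mul_nonneg (hf _) (hg _)) (a := (m, n)) (by simp)

theorem hasSum_coeff_mul {f g : PowerSeries ℝ} {φ a b : ℝ}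
    (ha : HasSum (fun n => PowerSeries.coeff n f * φ ^ n) a)
    (hb : HasSum (fun n => PowerSeries.coeff n g * φ ^ n) b) :
    HasSum (fun n => PowerSeries.coeff n (f * g) * φ ^ n) (a * b) := by
  have e : (fun n => PowerSeries.coeff n (f * g) * φ ^ n) = fun n =>
      ∑ p ∈ Finset.HasAntidiagonal.antidiagonal n, (PowerSeries.coeff p.1 f * φ ^ p.1) *
        (PowerSeries.coeff p.2 g * φ ^ p.2) := by
    funext n
    rw [PowerSeries.coeff_mul, Finset.sum_mul]
    refine Finset.sum_congr rfl fun p hp => ?_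
    rw [← Finset.HasAntidiagonal.mem_antidiagonal.1 hp, pow_add]
    ring
  have na : Summable fun n => ‖PowerSeries.coeff n f * φ ^ n‖ := ha.summable.norm
  have nb : Summable fun n => ‖PowerSeries.coeff n g * φ ^ n‖ := hb.summable.norm
  rw [e, ← ha.tsum_eq, ← hb.tsum_eq,
    tsum_mul_tsum_eq_tsum_sum_antidiagonal_of_summable_norm na nb]
  exact (summable_norm_sum_mul_antidiagonal_of_summable_norm na nb).of_norm.hasSum

theorem hasSum_coeff_prod {ι : Type*} (A : Finset ι) {f : ι → PowerSeries ℝ} {φ : ℝ} {z : ι → ℝ}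
    (hz : ∀ x ∈ A, HasSum (fun n => PowerSeries.coeff n (f x) * φ ^ n) (z x)) :
    HasSum (fun n => PowerSeries.coeff n (∏ x ∈ A, f x) * φ ^ n) (∏ x ∈ A, z x) := by
  classical
  induction A using Finset.induction_on with
  | empty =>
    simp only [Finset.prod_empty, PowerSeries.coeff_one]
    convert hasSum_ite_eq (0 : ℕ) (1 : ℝ) using 2 with n
    split_ifs with h <;> simp [h]
  | insert x s hx ih =>
    rw [Finset.prod_insert hx, Finset.prod_insert hx]
    exact hasSum_coeff_mul (hz x (Finset.mem_insert_self _ _)) (ih fun y hy => hz y (Finset.mem_insert_of_mem hy))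

/-! ### Subexponential weights. -/

/-- Weights with successive ratios tending to one are summable, with first moment, against any
geometric sequence. -/
theorem summable_succ_mul_geometric {v : ℕ → ℝ} (hv : ∀ n, 0 < v n)
    (h : Tendsto (fun n => v (n + 1) / v n) atTop (𝓝 1)) {r : ℝ} (hr : 0 < r) (hr1 : r < 1) :
    Summable fun n : ℕ => ((n : ℝ) + 1) * (v n * r ^ n) := by
  refine summable_of_ratio_test_tendsto_lt_one hr1
    (Eventually.of_forall fun n => by have := hv n; positivity) ?_
  have h1 : Tendsto (fun n : ℕ => ((n : ℝ) + 1 + 1) / ((n : ℝ) + 1)) atTop (𝓝 1) := by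
    have := (tendsto_one_div_add_atTop_nhds_zero_nat (𝕜 := ℝ)).const_add 1
    rw [add_zero] at this
    refine this.congr fun n => ?_
    have : (n : ℝ) + 1 ≠ 0 := by positivity
    field_simp
  have h2 := (h1.mul h).mul_const r
  simp only [one_mul] at h2
  refine h2.congr fun n => ?_
  have := hv n
  have := hv (n + 1)
  rw [Real.norm_of_nonneg (by positivity), Real.norm_of_nonneg (by positivity)]
  push_cast
  rw [pow_succ]
  field_simp

theorem summable_mul_geometric {v : ℕ → ℝ} (hv : ∀ n, 0 < v n)
    (h : Tendsto (fun n => v (n + 1) / v n) atTop (𝓝 1)) {r : ℝ} (hr : 0 < r) (hr1 : r < 1) :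
    Summable fun n : ℕ => v n * r ^ n :=
  (summable_succ_mul_geometric hv h hr hr1).of_nonneg_of_le
    (fun n => by have := hv n; positivity) fun n => by
      have := hv n
      have h2 : 0 ≤ v n * r ^ n := by positivity
      nlinarith [n.cast_nonneg (α := ℝ)]

/-- Weights with successive ratios tending to one decay slower than any geometric sequence. -/
theorem exists_mul_geometric_le {v : ℕ → ℝ} (hv : ∀ n, 0 < v n)
    (h : Tendsto (fun n => v (n + 1) / v n) atTop (𝓝 1)) {r : ℝ} (hr : 0 < r) (hr1 : r < 1) :
    ∃ c, 0 < c ∧ ∀ n, c * r ^ n ≤ v n := by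
  -- The reciprocals also have ratios tending to one, so their geometric series converges and its
  -- terms are bounded by its sum.
  have hs : Summable fun n => (v n)⁻¹ * r ^ n := by
    refine summable_mul_geometric (fun n => inv_pos.2 (hv n)) ?_ hr hr1
    have := h.inv₀ one_ne_zero
    rw [inv_one] at this
    refine this.congr fun n => ?_
    have := hv n
    have := hv (n + 1)
    field_simp
  have hpos : ∀ n, 0 < (v n)⁻¹ * r ^ n := fun n => by have := hv n; positivity
  have hle : ∀ n, (v n)⁻¹ * r ^ n ≤ ∑' n, (v n)⁻¹ * r ^ n := fun n =>
    hs.le_tsum n fun m _ => (hpos m).le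
  have hT := (hpos 0).trans_le (hle 0)
  refine ⟨_, inv_pos.2 hT, fun n => ?_⟩
  have h1 := hle n
  rw [inv_mul_le_iff₀ (hv n)] at h1
  rw [inv_mul_le_iff₀ hT]
  linarith

/-! ### Single-site estimates and growth of the density. -/

/-- The standing assumptions on the weights and the profile. -/
structure Regular (w : ℕ → ℕ → ℝ) (wlo whi lam : ℕ → ℝ) (C : ℝ) : Prop where
  wlo_pos : ∀ n, 0 < wlo n
  wlo_le : ∀ x n, wlo n ≤ w x n
  le_whi : ∀ x n, w x n ≤ whi n
  tendsto_wlo : Tendsto (fun n => wlo (n + 1) / wlo n) atTop (𝓝 1)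
  tendsto_whi : Tendsto (fun n => whi (n + 1) / whi n) atTop (𝓝 1)
  lam_pos : ∀ x, 0 < lam x
  lam_le : ∀ x, lam x ≤ C

namespace Regular

variable {w : ℕ → ℕ → ℝ} {wlo whi lam : ℕ → ℝ} {C : ℝ} (h : Regular w wlo whi lam C)

include h

theorem w_pos (x n : ℕ) : 0 < w x n := (h.wlo_pos n).trans_le (h.wlo_le x n)

theorem whi_pos (n : ℕ) : 0 < whi n := (h.w_pos 0 n).trans_le (h.le_whi 0 n)

theorem bddBelow : BddBelow (Set.range fun x => 1 / lam x) :=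
  ⟨0, by rintro _ ⟨x, rfl⟩; exact (one_div_pos.2 (h.lam_pos x)).le⟩

theorem critFugacity_pos : 0 < critFugacity lam := by
  have hC : 0 < C := (h.lam_pos 0).trans_le (h.lam_le 0)
  exact (one_div_pos.2 hC).trans_le
    (le_ciInf fun x => one_div_le_one_div_of_le (h.lam_pos x) (h.lam_le x))

theorem lam_mul_critFugacity_le (x : ℕ) : lam x * critFugacity lam ≤ 1 := by
  have h1 : critFugacity lam ≤ 1 / lam x := ciInf_le h.bddBelow x
  rw [le_div_iff₀ (h.lam_pos x)] at h1
  linarith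

/-- The infimum defining φ_c need not be attained. A nearly optimal site is enough to absorb the
surplus particles. -/
theorem exists_le_lam_mul_critFugacity {r : ℝ} (hr : 0 < r) (hr1 : r < 1) :
    ∃ y, r ≤ lam y * critFugacity lam := by
  have h1 : critFugacity lam < critFugacity lam / r := by
    rw [lt_div_iff₀ hr]; nlinarith [h.critFugacity_pos]
  obtain ⟨y, hy⟩ := exists_lt_of_ciInf_lt h1
  refine ⟨y, ?_⟩
  have := h.lam_pos y
  rw [div_lt_div_iff₀ this hr] at hy
  linarith

theorem lam_mul_le {φ : ℝ} (hφ : 0 < φ) (x : ℕ) : lam x * φ ≤ φ / critFugacity lam := by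
  rw [le_div_iff₀ h.critFugacity_pos]
  nlinarith [h.lam_mul_critFugacity_le x]

theorem siteWeight_pos {φ : ℝ} (hφ : 0 < φ) (x n : ℕ) : 0 < siteWeight w lam φ x n := by
  have := h.w_pos x n
  have := h.lam_pos x
  unfold siteWeight
  positivity

theorem siteWeight_le {φ r : ℝ} (hφ : 0 < φ) {x : ℕ} (hr : lam x * φ ≤ r) (n : ℕ) :
    siteWeight w lam φ x n ≤ whi n * r ^ n := by
  have := h.w_pos x n
  have := h.whi_pos n
  have := h.lam_pos x
  have := h.le_whi x n
  unfold siteWeight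
  gcongr

theorem summable_siteWeight {φ r : ℝ} (hφ : 0 < φ) (hr1 : r < 1) {x : ℕ} (hr : lam x * φ ≤ r) :
    Summable fun n => siteWeight w lam φ x n :=
  (summable_mul_geometric h.whi_pos h.tendsto_whi
    ((mul_pos (h.lam_pos x) hφ).trans_le hr) hr1).of_nonneg_of_le
    (fun n => (h.siteWeight_pos hφ x n).le) (h.siteWeight_le hφ hr)

theorem mul_siteWeight_le {φ r : ℝ} (hφ : 0 < φ) {x : ℕ} (hr : lam x * φ ≤ r) (n : ℕ) :
    n * siteWeight w lam φ x n ≤ ((n : ℝ) + 1) * (whi n * r ^ n) :=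
  mul_le_mul (by linarith) (h.siteWeight_le hφ hr n) (h.siteWeight_pos hφ x n).le (by positivity)

theorem summable_mul_siteWeight {φ r : ℝ} (hφ : 0 < φ) (hr1 : r < 1) {x : ℕ}
    (hr : lam x * φ ≤ r) : Summable fun n : ℕ => n * siteWeight w lam φ x n :=
  (summable_succ_mul_geometric h.whi_pos h.tendsto_whi
    ((mul_pos (h.lam_pos x) hφ).trans_le hr) hr1).of_nonneg_of_le
    (fun n => mul_nonneg n.cast_nonneg (h.siteWeight_pos hφ x n).le) (h.mul_siteWeight_le hφ hr)

theorem le_siteZ {φ : ℝ} (hφ : 0 < φ) {x : ℕ} (hs : Summable fun n => siteWeight w lam φ x n) :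
    w x 0 ≤ siteZ w lam φ x := by
  have := hs.le_tsum 0 fun n _ => (h.siteWeight_pos hφ x n).le
  simpa [siteWeight, siteZ] using this

theorem siteZ_pos {φ : ℝ} (hφ : 0 < φ) {x : ℕ} (hs : Summable fun n => siteWeight w lam φ x n) :
    0 < siteZ w lam φ x := (h.w_pos x 0).trans_le (h.le_siteZ hφ hs)

theorem siteZ_le {φ r : ℝ} (hφ : 0 < φ) (hr1 : r < 1) {x : ℕ} (hr : lam x * φ ≤ r) :
    siteZ w lam φ x ≤ ∑' n, whi n * r ^ n :=
  (h.summable_siteWeight hφ hr1 hr).tsum_le_tsum (h.siteWeight_le hφ hr)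
    (summable_mul_geometric h.whi_pos h.tendsto_whi
      ((mul_pos (h.lam_pos x) hφ).trans_le hr) hr1)

theorem siteDensity_nonneg {φ : ℝ} (hφ : 0 < φ) (x : ℕ) : 0 ≤ siteDensity w lam φ x :=
  div_nonneg (tsum_nonneg fun n => mul_nonneg n.cast_nonneg (h.siteWeight_pos hφ x n).le)
    (tsum_nonneg fun n => (h.siteWeight_pos hφ x n).le)

theorem siteDensity_le {φ r : ℝ} (hφ : 0 < φ) (hr1 : r < 1) {x : ℕ} (hr : lam x * φ ≤ r) :
    siteDensity w lam φ x ≤ (∑' n : ℕ, ((n : ℝ) + 1) * (whi n * r ^ n)) / wlo 0 := by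
  have hs := h.summable_siteWeight hφ hr1 hr
  refine div_le_div₀ (tsum_nonneg fun n => ?_) ?_ (h.wlo_pos 0)
    ((h.wlo_le x 0).trans (h.le_siteZ hφ hs))
  · have := h.whi_pos n
    have := (mul_pos (h.lam_pos x) hφ).trans_le hr
    positivity
  · exact (h.summable_mul_siteWeight hφ hr1 hr).tsum_le_tsum (h.mul_siteWeight_le hφ hr)
      (summable_succ_mul_geometric h.whi_pos h.tendsto_whi
      ((mul_pos (h.lam_pos x) hφ).trans_le hr) hr1)

omit h in
theorem siteWeight_mul_pow {φ ψ : ℝ} (hφ : 0 < φ) (x n : ℕ) :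
    siteWeight w lam φ x n * (ψ / φ) ^ n = siteWeight w lam ψ x n := by
  unfold siteWeight
  rw [mul_assoc, ← mul_pow]
  congr 2
  field_simp

/-- Jensen for the tilt ψ/φ, with no order between φ and ψ. It is used with ψ < φ, to control the
loss when the fugacity is lowered. -/
theorem siteZ_mul_rpow_le {φ ψ : ℝ} (hφ : 0 < φ) (hψ : 0 < ψ) {x : ℕ}
    (hz : Summable fun n => siteWeight w lam φ x n)
    (hS : Summable fun n : ℕ => n * siteWeight w lam φ x n)
    (hz' : Summable fun n => siteWeight w lam ψ x n) :
    siteZ w lam φ x * (ψ / φ) ^ siteDensity w lam φ x ≤ siteZ w lam ψ x := by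
  refine mul_rpow_mean_le (fun n => (h.siteWeight_pos hφ x n).le) (div_pos hψ hφ)
    (h.siteZ_pos hφ hz) hz.hasSum hS.hasSum ?_
  simpa only [siteWeight_mul_pow hφ, siteZ] using hz'.hasSum

theorem prod_siteZ_mul_rpow_le {φ ψ : ℝ} (hφ : 0 < φ) (hψ : 0 < ψ) {A : Finset ℕ}
    (hz : ∀ x ∈ A, Summable fun n => siteWeight w lam φ x n)
    (hS : ∀ x ∈ A, Summable fun n : ℕ => n * siteWeight w lam φ x n)
    (hz' : ∀ x ∈ A, Summable fun n => siteWeight w lam ψ x n) :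
    (∏ x ∈ A, siteZ w lam φ x) * (ψ / φ) ^ (∑ x ∈ A, siteDensity w lam φ x) ≤
      ∏ x ∈ A, siteZ w lam ψ x := by
  rw [Real.rpow_sum_of_pos (div_pos hψ hφ), ← Finset.prod_mul_distrib]
  refine Finset.prod_le_prod (fun x hx => ?_) fun x hx =>
    h.siteZ_mul_rpow_le hφ hψ (hz x hx) (hS x hx) (hz' x hx)
  have := h.siteZ_pos hφ (hz x hx)
  have := div_pos hψ hφ
  positivity

/-- The gain in `mean_mul_le_tilted_mean` depends on the site only through w_x(0) ≥ w_-(0) and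
z_x(ψ), which is bounded uniformly since λ_x ψ ≤ ψ/φ_c < 1. Uniformity lets the gain survive
averaging over sites. -/
theorem exists_siteDensity_mul_le {φ ψ : ℝ} (hφ : 0 < φ) (hφψ : φ < ψ)
    (hψ : ψ < critFugacity lam) :
    ∃ c, 0 < c ∧ ∀ x, siteDensity w lam φ x * (1 + c) ≤ siteDensity w lam ψ x := by
  have hψ0 := hφ.trans hφψ
  have hr1 : ψ / critFugacity lam < 1 := (div_lt_one h.critFugacity_pos).2 hψ
  set K := ∑' n, whi n * (ψ / critFugacity lam) ^ n with hK
  have hr : ∀ x, lam x * ψ ≤ ψ / critFugacity lam := h.lam_mul_le hψ0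
  have hr' : ∀ x, lam x * φ ≤ ψ / critFugacity lam := fun x =>
    (mul_le_mul_of_nonneg_left hφψ.le (h.lam_pos x).le).trans (hr x)
  have hKpos : 0 < K :=
    (h.siteZ_pos hψ0 (h.summable_siteWeight hψ0 hr1 (hr 0))).trans_le (h.siteZ_le hψ0 hr1 (hr 0))
  have hs : 1 < ψ / φ := (one_lt_div hφ).2 hφψ
  refine ⟨(ψ / φ - 1) * wlo 0 / K,
    div_pos (mul_pos (by linarith) (h.wlo_pos 0)) hKpos, fun x => ?_⟩
  have hzψ := h.summable_siteWeight hψ0 hr1 (hr x)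
  have key := mean_mul_le_tilted_mean (fun n => (h.siteWeight_pos hφ x n).le)
    (h.siteWeight_pos hφ x 0) (h.siteWeight_pos hφ x 1) hs
    (h.summable_siteWeight hφ hr1 (hr' x)).hasSum
    (h.summable_mul_siteWeight hφ hr1 (hr' x)).hasSum
    (z' := siteZ w lam ψ x) (S' := ∑' n : ℕ, n * siteWeight w lam ψ x n)
    (by simpa only [siteWeight_mul_pow hφ, siteZ] using hzψ.hasSum)
    (by simpa only [siteWeight_mul_pow hφ] using (h.summable_mul_siteWeight hψ0 hr1 (hr x)).hasSum)
  refine le_trans ?_ key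
  have h0 := h.siteDensity_nonneg hφ x
  have h1 : (ψ / φ - 1) * wlo 0 / K ≤
      (ψ / φ - 1) * siteWeight w lam φ x 0 / siteZ w lam ψ x := by
    have : wlo 0 ≤ siteWeight w lam φ x 0 := by simpa [siteWeight] using h.wlo_le x 0
    have h2 : (0 : ℝ) ≤ ψ / φ - 1 := by linarith
    exact div_le_div₀ (mul_nonneg h2 (h.siteWeight_pos hφ x 0).le)
      (mul_le_mul_of_nonneg_left this h2) (h.siteZ_pos hψ0 hzψ) (h.siteZ_le hψ0 hr1 (hr x))
  exact mul_le_mul_of_nonneg_left (by linarith) h0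

omit h in
theorem tendsto_avgDensity {φ : ℝ} (hφ : φ ∈ densityDomain w lam) :
    Tendsto (avgDensity w lam φ) atTop (𝓝 (limitDensity w lam φ)) :=
  tendsto_nhds_limUnder hφ.2.2.2

theorem avgDensity_nonneg {φ : ℝ} (hφ : 0 < φ) (L : ℕ) : 0 ≤ avgDensity w lam φ L :=
  div_nonneg (Finset.sum_nonneg fun x _ => h.siteDensity_nonneg hφ x) L.cast_nonneg

theorem sum_siteDensity_le {φ : ℝ} (hφ : 0 < φ) {A : Finset ℕ} {L : ℕ}
    (hA : A ⊆ Finset.range L) :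
    ∑ x ∈ A, siteDensity w lam φ x ≤ avgDensity w lam φ L * L := by
  rcases Nat.eq_zero_or_pos L with rfl | hL
  · have : A = ∅ := by simpa using hA
    simp [this]
  · have : (L : ℝ) ≠ 0 := by positivity
    rw [avgDensity, div_mul_cancel₀ _ this]
    exact Finset.sum_le_sum_of_subset_of_nonneg hA fun x _ _ => h.siteDensity_nonneg hφ x

section Domain

variable (hD : Set.Ico 0 (critFugacity lam) ⊆ densityDomain w lam)
include hD

theorem limitDensity_nonneg {φ : ℝ} (hφ : 0 < φ) (hφc : φ < critFugacity lam) :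
    0 ≤ limitDensity w lam φ :=
  ge_of_tendsto' (tendsto_avgDensity (hD ⟨hφ.le, hφc⟩)) (h.avgDensity_nonneg hφ)

theorem exists_limitDensity_mul_le {φ ψ : ℝ} (hφ : 0 < φ) (hφψ : φ < ψ)
    (hψ : ψ < critFugacity lam) :
    ∃ c, 0 < c ∧ limitDensity w lam φ * (1 + c) ≤ limitDensity w lam ψ := by
  obtain ⟨c, hc, hcx⟩ := h.exists_siteDensity_mul_le hφ hφψ hψ
  refine ⟨c, hc, le_of_tendsto_of_tendsto'
    ((tendsto_avgDensity (hD ⟨hφ.le, hφψ.trans hψ⟩)).mul_const (1 + c))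
    (tendsto_avgDensity (hD ⟨(hφ.trans hφψ).le, hψ⟩)) fun L => ?_⟩
  rw [avgDensity, avgDensity, div_mul_eq_mul_div, Finset.sum_mul]
  gcongr
  exact hcx _

theorem limitDensity_mono {φ ψ : ℝ} (hφ : 0 < φ) (hφψ : φ < ψ) (hψ : ψ < critFugacity lam) :
    limitDensity w lam φ ≤ limitDensity w lam ψ := by
  obtain ⟨c, hc, hle⟩ := h.exists_limitDensity_mul_le hD hφ hφψ hψ
  have := h.limitDensity_nonneg hD hφ (hφψ.trans hψ)
  nlinarith

variable {ρc : ℝ} (hρc : Tendsto (limitDensity w lam) (𝓝[<] (critFugacity lam)) (𝓝 ρc))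
include hρc

theorem limitDensity_le {φ : ℝ} (hφ : 0 < φ) (hφc : φ < critFugacity lam) :
    limitDensity w lam φ ≤ ρc := by
  refine ge_of_tendsto hρc ?_
  filter_upwards [Ioo_mem_nhdsLT hφc] with ψ hψ
  exact h.limitDensity_mono hD hφ hψ.1 hψ.2

/-- A multiplicative gain is a strict increase only when the density is positive, so a vanishing
limiting density is a separate case. -/
theorem limitDensity_lt_or_eq_zero {φ : ℝ} (hφ : 0 < φ) (hφc : φ < critFugacity lam) :
    limitDensity w lam φ < ρc ∨ limitDensity w lam φ = 0 := by
  obtain ⟨ψ, hφψ, hψ⟩ := exists_between hφc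
  obtain ⟨c, hc, hle⟩ := h.exists_limitDensity_mul_le hD hφ hφψ hψ
  have h1 := h.limitDensity_le hD hρc (hφ.trans hφψ) hψ
  rcases eq_or_lt_of_le (h.limitDensity_nonneg hD hφ hφc) with h0 | h0
  · exact Or.inr h0.symm
  · left
    nlinarith

end Domain

end Regular

/-! ### Generating functions and lower bounds on partition functions. -/

/-- The generating function `∑ n, w_x(n) λ_x^n X^n` of a site. -/
noncomputable def genFun (w : ℕ → ℕ → ℝ) (lam : ℕ → ℝ) (x : ℕ) : PowerSeries ℝ :=
  PowerSeries.mk fun n => w x n * lam x ^ n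

/-- The grand-canonical partition function on `A` restricted to at most `N` particles. -/
noncomputable def partialZ (w : ℕ → ℕ → ℝ) (lam : ℕ → ℝ) (A : Finset ℕ) (N : ℕ) (φ : ℝ) : ℝ :=
  ∑ m ∈ Finset.range (N + 1), PowerSeries.coeff m (∏ x ∈ A, genFun w lam x) * φ ^ m

theorem coeff_genFun (w : ℕ → ℕ → ℝ) (lam : ℕ → ℝ) (x n : ℕ) :
    PowerSeries.coeff n (genFun w lam x) = w x n * lam x ^ n := by simp [genFun]

theorem coeff_genFun_mul_pow (w : ℕ → ℕ → ℝ) (lam : ℕ → ℝ) (φ : ℝ) (x n : ℕ) :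
    PowerSeries.coeff n (genFun w lam x) * φ ^ n = siteWeight w lam φ x n := by
  rw [coeff_genFun, siteWeight, mul_pow, mul_assoc]

theorem coeff_zero_prod_genFun (w : ℕ → ℕ → ℝ) (lam : ℕ → ℝ) (A : Finset ℕ) :
    PowerSeries.coeff 0 (∏ x ∈ A, genFun w lam x) = ∏ x ∈ A, w x 0 := by
  rw [PowerSeries.coeff_zero_eq_constantCoeff_apply, map_prod]
  refine Finset.prod_congr rfl fun x _ => ?_
  rw [← PowerSeries.coeff_zero_eq_constantCoeff_apply, coeff_genFun]
  simp

/-- Canonical partition functions become coefficients of a product, so splitting the lattice into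
disjoint pieces becomes a Cauchy product. -/
theorem canonicalZ_eq_coeff (w : ℕ → ℕ → ℝ) (lam : ℕ → ℝ) (A : Finset ℕ) (N : ℕ) :
    canonicalZ w lam A N = PowerSeries.coeff N (∏ x ∈ A, genFun w lam x) := by
  rw [← Finset.prod_coe_sort, PowerSeries.coeff_prod, canonicalZ]
  symm
  refine Finset.sum_bij' (fun l _ => ⇑l) (fun η _ => Finsupp.equivFunOnFinite.symm η) ?_ ?_ ?_ ?_ ?_
  · intro l hl
    simpa using (Finset.mem_finsuppAntidiag.1 hl).1
  · intro η hη
    simpa [Finset.mem_finsuppAntidiag] using hη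
  · intro l _
    ext; simp
  · intro η _
    ext; simp
  · intro l _
    simp [configWeight, coeff_genFun]

namespace Regular

variable {w : ℕ → ℕ → ℝ} {wlo whi lam : ℕ → ℝ} {C : ℝ} (h : Regular w wlo whi lam C)

include h

theorem coeff_genFun_nonneg (x n : ℕ) : 0 ≤ PowerSeries.coeff n (genFun w lam x) := by
  rw [coeff_genFun]
  have := h.w_pos x n
  have := h.lam_pos x
  positivity

theorem coeff_prod_genFun_nonneg (A : Finset ℕ) (n : ℕ) :
    0 ≤ PowerSeries.coeff n (∏ x ∈ A, genFun w lam x) :=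
  coeff_prod_nonneg A h.coeff_genFun_nonneg n

omit h in
theorem hasSum_coeff_prod_genFun {A : Finset ℕ} {φ : ℝ}
    (hs : ∀ x ∈ A, Summable fun n => siteWeight w lam φ x n) :
    HasSum (fun n => PowerSeries.coeff n (∏ x ∈ A, genFun w lam x) * φ ^ n)
      (∏ x ∈ A, siteZ w lam φ x) := by
  refine hasSum_coeff_prod A fun x hx => ?_
  simp only [coeff_genFun_mul_pow]
  exact (hs x hx).hasSum

theorem partialZ_mono {φ ψ : ℝ} (hφ : 0 < φ) (hφψ : φ ≤ ψ) (A : Finset ℕ) (N : ℕ) :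
    partialZ w lam A N φ ≤ partialZ w lam A N ψ := by
  unfold partialZ
  gcongr
  exact h.coeff_prod_genFun_nonneg A _

theorem prod_le_partialZ {φ : ℝ} (hφ : 0 < φ) (A : Finset ℕ) (N : ℕ) :
    ∏ x ∈ A, w x 0 ≤ partialZ w lam A N φ := by
  have := Finset.single_le_sum (s := Finset.range (N + 1)) (a := 0)
    (f := fun m => PowerSeries.coeff m (∏ x ∈ A, genFun w lam x) * φ ^ m)
    (fun m _ => mul_nonneg (h.coeff_prod_genFun_nonneg A m) (pow_nonneg hφ.le m)) (by simp)
  simpa only [pow_zero, mul_one, coeff_zero_prod_genFun, partialZ] using this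

/-- Chernoff bound for the number of particles exceeding `N`. -/
theorem prod_siteZ_le_partialZ_add {φ ψ : ℝ} (hφ : 0 < φ) (hφψ : φ ≤ ψ) {A : Finset ℕ}
    (hs : ∀ x ∈ A, Summable fun n => siteWeight w lam φ x n)
    (hs' : ∀ x ∈ A, Summable fun n => siteWeight w lam ψ x n) (N : ℕ) :
    ∏ x ∈ A, siteZ w lam φ x ≤
      partialZ w lam A N φ + (φ / ψ) ^ N * ∏ x ∈ A, siteZ w lam ψ x := by
  have hψ := hφ.trans_le hφψ
  have h1 : HasSum (fun m => if m ∈ Finset.range (N + 1) then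
      PowerSeries.coeff m (∏ x ∈ A, genFun w lam x) * φ ^ m else 0) (partialZ w lam A N φ) := by
    have := hasSum_sum_of_ne_finset_zero (L := .unconditional ℕ) (s := Finset.range (N + 1)) (f := fun m =>
      if m ∈ Finset.range (N + 1) then
        PowerSeries.coeff m (∏ x ∈ A, genFun w lam x) * φ ^ m else 0)
      (fun b hb => if_neg hb)
    convert this using 1
    exact Finset.sum_congr rfl fun m hm => (if_pos hm).symm
  refine hasSum_le (fun m => ?_) (hasSum_coeff_prod_genFun hs)
    (h1.add ((hasSum_coeff_prod_genFun hs').mul_left ((φ / ψ) ^ N)))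
  have hc := h.coeff_prod_genFun_nonneg A m
  split_ifs with hm
  · have : 0 ≤ (φ / ψ) ^ N * (PowerSeries.coeff m (∏ x ∈ A, genFun w lam x) * ψ ^ m) := by
      positivity
    linarith
  · have hNm : N ≤ m := by simp at hm; omega
    have h2 : φ ^ m = (φ / ψ) ^ m * ψ ^ m := by rw [← mul_pow]; congr 1; field_simp
    have h3 : (φ / ψ) ^ m ≤ (φ / ψ) ^ N :=
      pow_le_pow_of_le_one (by positivity) ((div_le_one hψ).2 hφψ) hNm
    rw [zero_add, h2]
    calc _ = (φ / ψ) ^ m * (PowerSeries.coeff m (∏ x ∈ A, genFun w lam x) * ψ ^ m) := by ring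
      _ ≤ _ := by gcongr

/-- Nonzero occupations contribute at most z_x R_x to z_x. Where the average density vanishes, the
partition function is thus close, on the exponential scale, to the weight of the empty
configuration. -/
theorem siteZ_le_mul_exp {φ r : ℝ} (hφ : 0 < φ) (hr1 : r < 1) {x : ℕ} (hr : lam x * φ ≤ r) :
    siteZ w lam φ x ≤
      w x 0 * Real.exp ((∑' n, whi n * r ^ n) / wlo 0 * siteDensity w lam φ x) := by
  have hs := h.summable_siteWeight hφ hr1 hr
  have hS := h.summable_mul_siteWeight hφ hr1 hr
  have hz := h.siteZ_pos hφ hs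
  have hw0 := h.w_pos x 0
  have hK := h.siteZ_le hφ hr1 hr
  have hR := h.siteDensity_nonneg hφ x
  have e1 : ∑' n : ℕ, n * siteWeight w lam φ x n
      = siteZ w lam φ x * siteDensity w lam φ x := by
    unfold siteDensity; field_simp
  have h1 : siteZ w lam φ x ≤ w x 0 + siteZ w lam φ x * siteDensity w lam φ x := by
    rw [← e1]
    refine hasSum_le (fun n => ?_) hs.hasSum ((hasSum_ite_eq 0 (w x 0)).add hS.hasSum)
    rcases eq_or_ne n 0 with rfl | hn
    · simp [siteWeight]
    · have : (1 : ℝ) ≤ n := by exact_mod_cast Nat.one_le_iff_ne_zero.2 hn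
      have := h.siteWeight_pos hφ x n
      simp only [hn, if_false]
      nlinarith
  refine h1.trans ?_
  have h2 : siteZ w lam φ x ≤ w x 0 * ((∑' n, whi n * r ^ n) / wlo 0) := by
    rw [mul_div_assoc', le_div_iff₀ (h.wlo_pos 0)]
    have := h.wlo_le x 0
    have := h.wlo_pos 0
    nlinarith
  have h3 := Real.add_one_le_exp ((∑' n, whi n * r ^ n) / wlo 0 * siteDensity w lam φ x)
  calc w x 0 + siteZ w lam φ x * siteDensity w lam φ x
      ≤ w x 0 + w x 0 * ((∑' n, whi n * r ^ n) / wlo 0) * siteDensity w lam φ x := by gcongr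
    _ = w x 0 * ((∑' n, whi n * r ^ n) / wlo 0 * siteDensity w lam φ x + 1) := by ring
    _ ≤ _ := by gcongr

/-- Keep only configurations with m ≤ N particles on A, the remaining N - m on y, and none
elsewhere. -/
theorem canonicalZ_lower {φ r c : ℝ} (hφ : 0 < φ) (hr : 0 < r) (hr1 : r ≤ 1) (hc : 0 < c)
    (hcr : ∀ n, c * r ^ n ≤ wlo n) {A Λ : Finset ℕ} (hA : A ⊆ Λ) {y : ℕ} (hy : y ∈ Λ)
    (hyA : y ∉ A) (hry : r ≤ lam y * φ) (N : ℕ) :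
    (∏ x ∈ (Λ \ A).erase y, w x 0) * (c * (r * r) ^ N) * partialZ w lam A N φ ≤
      φ ^ N * canonicalZ w lam Λ N := by
  have hyU : y ∈ Λ \ A := Finset.mem_sdiff.2 ⟨hy, hyA⟩
  have e : ∏ x ∈ Λ, genFun w lam x = (∏ x ∈ A, genFun w lam x) *
      ((∏ x ∈ (Λ \ A).erase y, genFun w lam x) * genFun w lam y) := by
    rw [Finset.prod_erase_mul _ _ hyU, mul_comm, Finset.prod_sdiff hA]
  have hP : 0 ≤ ∏ x ∈ (Λ \ A).erase y, w x 0 := Finset.prod_nonneg fun x _ => (h.w_pos x 0).le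
  rw [canonicalZ_eq_coeff, e, PowerSeries.coeff_mul,
    Finset.Nat.sum_antidiagonal_eq_sum_range_succ
      (fun i j => PowerSeries.coeff i (∏ x ∈ A, genFun w lam x) * PowerSeries.coeff j
        ((∏ x ∈ (Λ \ A).erase y, genFun w lam x) * genFun w lam y)),
    partialZ, Finset.mul_sum, Finset.mul_sum]
  refine Finset.sum_le_sum fun m hm => ?_
  have hmN : m ≤ N := by simp at hm; omega
  have h1 : (∏ x ∈ (Λ \ A).erase y, w x 0) * (w y (N - m) * lam y ^ (N - m)) ≤
      PowerSeries.coeff (N - m)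
        ((∏ x ∈ (Λ \ A).erase y, genFun w lam x) * genFun w lam y) := by
    have := coeff_mul_coeff_le (h.coeff_prod_genFun_nonneg ((Λ \ A).erase y))
      (h.coeff_genFun_nonneg y) 0 (N - m)
    rwa [coeff_zero_prod_genFun, coeff_genFun, zero_add] at this
  -- One factor r pays for w_y, the other for λ_y φ being only at least r. Raising the exponent from
  -- N - m to N makes the bound uniform in m.
  have h2 : c * (r * r) ^ N ≤ w y (N - m) * (lam y * φ) ^ (N - m) := by
    calc c * (r * r) ^ N ≤ c * (r * r) ^ (N - m) := by
          gcongr c * ?_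
          exact pow_le_pow_of_le_one (by positivity) (by nlinarith) (Nat.sub_le _ _)
      _ = c * r ^ (N - m) * r ^ (N - m) := by rw [mul_pow, mul_assoc]
      _ ≤ _ := by
          have := (hcr (N - m)).trans (h.wlo_le y (N - m))
          have := h.w_pos y (N - m)
          gcongr
  have hc0 := h.coeff_prod_genFun_nonneg A m
  calc _ = PowerSeries.coeff m (∏ x ∈ A, genFun w lam x) * φ ^ m *
        ((∏ x ∈ (Λ \ A).erase y, w x 0) * (c * (r * r) ^ N)) := by ring
    _ ≤ PowerSeries.coeff m (∏ x ∈ A, genFun w lam x) * φ ^ m *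
        ((∏ x ∈ (Λ \ A).erase y, w x 0) * (w y (N - m) * (lam y * φ) ^ (N - m))) := by gcongr
    _ = PowerSeries.coeff m (∏ x ∈ A, genFun w lam x) * (φ ^ m * φ ^ (N - m)) *
        ((∏ x ∈ (Λ \ A).erase y, w x 0) * (w y (N - m) * lam y ^ (N - m))) := by
          rw [mul_pow]; ring
    _ = φ ^ N * (PowerSeries.coeff m (∏ x ∈ A, genFun w lam x) *
        ((∏ x ∈ (Λ \ A).erase y, w x 0) * (w y (N - m) * lam y ^ (N - m)))) := by
          rw [← pow_add, Nat.add_sub_cancel' hmN]; ring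
    _ ≤ _ := by gcongr

section Domain

variable (hD : Set.Ico 0 (critFugacity lam) ⊆ densityDomain w lam)
  {ρc : ℝ} (hρc : Tendsto (limitDensity w lam) (𝓝[<] (critFugacity lam)) (𝓝 ρc))
include hD hρc

/-- For φ < ψ < φ_c, the Chernoff bound and Jensen give an excess of at most (φ/ψ)^{N - D} times the
partition function, D being the mean particle number at ψ. If R(ψ) < ρ this decays exponentially in
L; otherwise R(ψ) = 0 and the empty configuration alone suffices. -/
theorem eventually_exp_mul_prod_siteZ_le_partialZ {ρ : ℝ} (hρ : ρc ≤ ρ) {N : ℕ → ℕ}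
    (hN : Tendsto (fun L : ℕ => (N L : ℝ) / L) atTop (𝓝 ρ)) {φ : ℝ} (hφ : 0 < φ)
    (hφc : φ < critFugacity lam) {η : ℝ} (hη : 0 < η) :
    ∀ᶠ L : ℕ in atTop, ∀ A ⊆ Finset.range L,
      Real.exp (-(η * L)) * ∏ x ∈ A, siteZ w lam φ x ≤ partialZ w lam A (N L) φ := by
  have hc0 := h.critFugacity_pos
  have hLtop : Tendsto (fun L : ℕ => (L : ℝ)) atTop atTop := tendsto_natCast_atTop_atTop
  obtain ⟨ψ, hφψ, hψc⟩ := exists_between hφc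
  have hψ := hφ.trans hφψ
  have hr1 : ψ / critFugacity lam < 1 := (div_lt_one hc0).2 hψc
  have hrψ : ∀ x, lam x * ψ ≤ ψ / critFugacity lam := h.lam_mul_le hψ
  have hrφ : ∀ x, lam x * φ ≤ ψ / critFugacity lam := fun x =>
    (mul_le_mul_of_nonneg_left hφψ.le (h.lam_pos x).le).trans (hrψ x)
  have hsφ := fun x => h.summable_siteWeight hφ hr1 (hrφ x)
  have hsψ := fun x => h.summable_siteWeight hψ hr1 (hrψ x)
  have hZ : ∀ A : Finset ℕ, 0 < ∏ x ∈ A, siteZ w lam φ x := fun A =>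
    Finset.prod_pos fun x _ => h.siteZ_pos hφ (hsφ x)
  have hlt := h.limitDensity_lt_or_eq_zero hD hρc hψ hψc
  by_cases hcase : limitDensity w lam ψ < ρ
  · set R := limitDensity w lam ψ
    -- Half the density gap: errors of d/2 in both N/L and the average density still leave N - D ≥
    -- dL.
    set d := (ρ - R) / 2 with hd
    have hd0 : 0 < d := by linarith
    have hq0 : 0 < φ / ψ := by positivity
    have hq1 : φ / ψ < 1 := (div_lt_one hψ).2 hφψ
    have hR := tendsto_avgDensity (hD ⟨hψ.le, hψc⟩)
    have hlim1 : Tendsto (fun L : ℕ => (φ / ψ) ^ (d * (L : ℝ))) atTop (𝓝 0) :=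
      (tendsto_rpow_atTop_of_base_lt_one _ (by linarith) hq1).comp (hLtop.const_mul_atTop hd0)
    have hlim2 : Tendsto (fun L : ℕ => Real.exp (-(η * L))) atTop (𝓝 0) :=
      Real.tendsto_exp_neg_atTop_nhds_zero.comp (hLtop.const_mul_atTop hη)
    filter_upwards [hlim1.eventually (gt_mem_nhds (show (0 : ℝ) < 1 / 2 by norm_num)),
      hlim2.eventually (gt_mem_nhds (show (0 : ℝ) < 1 / 2 by norm_num)),
      hR.eventually (gt_mem_nhds (show R < R + d / 2 by linarith)),
      hN.eventually (lt_mem_nhds (show ρ - d / 2 < ρ by linarith)), eventually_gt_atTop 0]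
      with L h1 h2 h3 h4 hL A hA
    have hL' : (0 : ℝ) < L := by exact_mod_cast hL
    have h5 := h.prod_siteZ_le_partialZ_add hφ hφψ.le (fun x _ => hsφ x) (fun x _ => hsψ x)
      (A := A) (N L)
    have h6 := h.prod_siteZ_mul_rpow_le hψ hφ (A := A) (fun x _ => hsψ x)
      (fun x _ => h.summable_mul_siteWeight hψ hr1 (hrψ x)) (fun x _ => hsφ x)
    have h7 := h.sum_siteDensity_le hψ hA
    set D := ∑ x ∈ A, siteDensity w lam ψ x
    have h8 : d * L ≤ N L - D := by
      rw [lt_div_iff₀ hL'] at h4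
      nlinarith
    have h9 : (φ / ψ) ^ N L * ∏ x ∈ A, siteZ w lam ψ x ≤ 1 / 2 * ∏ x ∈ A, siteZ w lam φ x := by
      have e : (φ / ψ) ^ N L = (φ / ψ) ^ ((N L : ℝ) - D) * (φ / ψ) ^ D := by
        rw [← Real.rpow_add hq0, sub_add_cancel, Real.rpow_natCast]
      calc _ = (φ / ψ) ^ ((N L : ℝ) - D) * ((∏ x ∈ A, siteZ w lam ψ x) * (φ / ψ) ^ D) := by
            rw [e]; ring
        _ ≤ (φ / ψ) ^ (d * (L : ℝ)) * ∏ x ∈ A, siteZ w lam φ x := by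
            refine mul_le_mul (Real.rpow_le_rpow_of_exponent_ge hq0 hq1.le h8) h6 ?_ ?_
            · have : 0 < ∏ x ∈ A, siteZ w lam ψ x :=
                Finset.prod_pos fun x _ => h.siteZ_pos hψ (hsψ x)
              positivity
            · positivity
        _ ≤ _ := by
            have := hZ A
            gcongr
    have := mul_le_mul_of_nonneg_right h2.le (hZ A).le
    linarith
  · have hR0 : limitDensity w lam ψ = 0 := by
      rcases hlt with hlt | hlt
      · exact absurd (hlt.trans_le hρ) hcase
      · exact hlt
    have hRφ : limitDensity w lam φ = 0 :=
      le_antisymm (hR0 ▸ h.limitDensity_mono hD hφ hφψ hψc) (h.limitDensity_nonneg hD hφ hφc)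
    set K := (∑' n, whi n * (ψ / critFugacity lam) ^ n) / wlo 0
    have hK0 : 0 ≤ K := div_nonneg (tsum_nonneg fun n => by
      have := h.whi_pos n
      positivity) (h.wlo_pos 0).le
    have hlim := (tendsto_avgDensity (hD ⟨hφ.le, hφc⟩)).const_mul K
    rw [hRφ, mul_zero] at hlim
    filter_upwards [hlim.eventually (gt_mem_nhds hη)] with L hL A hA
    refine le_trans ?_ (h.prod_le_partialZ hφ A (N L))
    have h1 : ∏ x ∈ A, siteZ w lam φ x ≤
        (∏ x ∈ A, w x 0) * Real.exp (K * ∑ x ∈ A, siteDensity w lam φ x) := by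
      rw [Finset.mul_sum, Real.exp_sum, ← Finset.prod_mul_distrib]
      exact Finset.prod_le_prod (fun x _ => (h.siteZ_pos hφ (hsφ x)).le) fun x _ =>
        h.siteZ_le_mul_exp hφ hr1 (hrφ x)
    have hW : 0 ≤ ∏ x ∈ A, w x 0 := Finset.prod_nonneg fun x _ => (h.w_pos x 0).le
    have h2 : K * ∑ x ∈ A, siteDensity w lam φ x ≤ η * L := by
      have := mul_le_mul_of_nonneg_left (h.sum_siteDensity_le hφ hA) hK0
      have : K * avgDensity w lam φ L * L ≤ η * L := by gcongr
      linarith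
    calc _ ≤ Real.exp (-(η * L)) * ((∏ x ∈ A, w x 0) * Real.exp (η * L)) := by
          have := h1.trans (mul_le_mul_of_nonneg_left (Real.exp_le_exp.2 h2) hW)
          gcongr
      _ = ∏ x ∈ A, w x 0 := by
          rw [mul_comm, mul_assoc, ← Real.exp_add]; simp

/-- The Chernoff argument needs room above the fugacity, so it is run at φ_c e^{-κ}. The restricted
sum is monotone in φ, and Jensen bounds the loss in the full partition function by e^{-κ M L}. -/
theorem eventually_exp_mul_prod_siteZ_le_partialZ_critFugacity {ρ : ℝ} (hρ : ρc ≤ ρ) {N : ℕ → ℕ}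
    (hN : Tendsto (fun L : ℕ => (N L : ℝ) / L) atTop (𝓝 ρ)) {B : ℕ → Finset ℕ}
    (hB : ∀ L, B L ⊆ Finset.range L)
    (hs : ∀ L, ∀ x ∈ B L, Summable fun n => siteWeight w lam (critFugacity lam) x n)
    (hS : ∀ L, ∀ x ∈ B L, Summable fun n : ℕ => n * siteWeight w lam (critFugacity lam) x n)
    {M : ℝ} (hM : ∀ᶠ L : ℕ in atTop,
      ∑ x ∈ B L, siteDensity w lam (critFugacity lam) x ≤ M * L)
    {η : ℝ} (hη : 0 < η) :
    ∀ᶠ L : ℕ in atTop, ∀ A ⊆ B L,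
      Real.exp (-(η * L)) * ∏ x ∈ A, siteZ w lam (critFugacity lam) x ≤
        partialZ w lam A (N L) (critFugacity lam) := by
  have hc0 := h.critFugacity_pos
  -- Chosen so that κM ≤ η/2; the other η/2 is spent at the lower fugacity.
  set κ := η / (2 * (|M| + 1)) with hκ
  have hκ0 : 0 < κ := by positivity
  set φ := critFugacity lam * Real.exp (-κ) with hφdef
  have hφ : 0 < φ := by positivity
  have hφc : φ < critFugacity lam := by
    have : Real.exp (-κ) < 1 := by
      rw [← Real.exp_zero]; exact Real.exp_lt_exp.2 (by linarith)
    nlinarith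
  have hr1 : φ / critFugacity lam < 1 := (div_lt_one hc0).2 hφc
  have hq : φ / critFugacity lam = Real.exp (-κ) := by rw [hφdef]; field_simp
  filter_upwards [hM, h.eventually_exp_mul_prod_siteZ_le_partialZ hD hρc hρ hN hφ hφc
    (half_pos hη)] with L hL hL2 A hA
  have h1 := hL2 A (hA.trans (hB L))
  have h2 := h.prod_siteZ_mul_rpow_le hc0 hφ (A := A) (fun x hx => hs L x (hA hx))
      (fun x hx => hS L x (hA hx)) (fun x _ => h.summable_siteWeight hφ hr1 (h.lam_mul_le hφ x))
  have h3 : ∑ x ∈ A, siteDensity w lam (critFugacity lam) x ≤ M * L :=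
    (Finset.sum_le_sum_of_subset_of_nonneg hA fun x _ _ => h.siteDensity_nonneg hc0 x).trans hL
  have hZ : 0 ≤ ∏ x ∈ A, siteZ w lam (critFugacity lam) x :=
    Finset.prod_nonneg fun x hx => (h.siteZ_pos hc0 (hs L x (hA hx))).le
  have hκM : κ * (M * L) ≤ η / 2 * L := by
    have e : κ * (|M| + 1) = η / 2 := by rw [hκ]; field_simp
    have : κ * M ≤ η / 2 := by nlinarith [le_abs_self M]
    nlinarith [L.cast_nonneg (α := ℝ)]
  rw [hq, ← Real.exp_mul] at h2
  have h4 : Real.exp (-(η / 2 * L)) ≤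
      Real.exp (-κ * ∑ x ∈ A, siteDensity w lam (critFugacity lam) x) := by
    refine Real.exp_le_exp.2 ?_
    nlinarith
  refine le_trans ?_ (h.partialZ_mono hφ hφc.le A (N L))
  refine le_trans ?_ h1
  calc _ = Real.exp (-(η / 2 * L)) * ((∏ x ∈ A, siteZ w lam (critFugacity lam) x) *
        Real.exp (-(η / 2 * L))) := by
        rw [show -(η * (L : ℝ)) = -(η / 2 * L) + -(η / 2 * L) by ring, Real.exp_add]; ring
    _ ≤ _ := by
        gcongr
        exact (mul_le_mul_of_nonneg_left h4 hZ).trans h2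

end Domain

end Regular

/-! ### Point masses and domination by the critical product measure. -/

theorem mem_trapPart {lam : ℕ → ℝ} {L x : ℕ} :
    x ∈ trapPart lam L ↔ x ∈ Finset.range L ∧ x ∈ trapSites lam := by
  classical
  exact Finset.mem_filter

theorem trapPart_subset (lam : ℕ → ℝ) (L : ℕ) : trapPart lam L ⊆ Finset.range L :=
  fun _ hx => (mem_trapPart.1 hx).1

theorem siteMeasure_singleton (w : ℕ → ℕ → ℝ) (lam : ℕ → ℝ) (φ : ℝ) (x n : ℕ) :
    siteMeasure w lam φ x {n} =
      ENNReal.ofReal (siteWeight w lam φ x n / siteZ w lam φ x) :=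
  Measure.sum_smul_dirac_singleton

theorem isProbabilityMeasure_siteMeasure {w : ℕ → ℕ → ℝ} {lam : ℕ → ℝ} {φ : ℝ} {x : ℕ}
    (h0 : ∀ n, 0 ≤ siteWeight w lam φ x n) (hz : 0 < siteZ w lam φ x)
    (hs : Summable fun n => siteWeight w lam φ x n) :
    IsProbabilityMeasure (siteMeasure w lam φ x) := by
  constructor
  rw [siteMeasure, Measure.sum_apply _ MeasurableSet.univ]
  simp only [Measure.smul_apply, measure_univ, smul_eq_mul, mul_one]
  rw [← ENNReal.ofReal_tsum_of_nonneg (fun n => div_nonneg (h0 n) hz.le) (hs.div_const _),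
    tsum_div_const]
  change ENNReal.ofReal (siteZ w lam φ x / siteZ w lam φ x) = 1
  rw [div_self hz.ne', ENNReal.ofReal_one]

namespace Regular

variable {w : ℕ → ℕ → ℝ} {wlo whi lam : ℕ → ℝ} {C : ℝ} (h : Regular w wlo whi lam C)

include h

theorem isProbabilityMeasure_grandCanonical {φ : ℝ} (hφ : 0 < φ) {A : Finset ℕ}
    (hs : ∀ x ∈ A, Summable fun n => siteWeight w lam φ x n) :
    IsProbabilityMeasure (grandCanonical w lam φ A) := by
  have : ∀ x : A, IsProbabilityMeasure (siteMeasure w lam φ x) := fun x =>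
    isProbabilityMeasure_siteMeasure (fun n => (h.siteWeight_pos hφ x n).le)
      (h.siteZ_pos hφ (hs x x.2)) (hs x x.2)
  unfold grandCanonical
  infer_instance

theorem grandCanonical_singleton {φ : ℝ} (hφ : 0 < φ) {A : Finset ℕ}
    (hs : ∀ x ∈ A, Summable fun n => siteWeight w lam φ x n) (η : A → ℕ) :
    grandCanonical w lam φ A {η} =
      ENNReal.ofReal ((∏ x : A, siteWeight w lam φ x (η x)) / ∏ x ∈ A, siteZ w lam φ x) := by
  have : ∀ x : A, IsProbabilityMeasure (siteMeasure w lam φ x) := fun x =>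
    isProbabilityMeasure_siteMeasure (fun n => (h.siteWeight_pos hφ x n).le)
      (h.siteZ_pos hφ (hs x x.2)) (hs x x.2)
  rw [grandCanonical, Measure.pi_singleton]
  simp only [siteMeasure_singleton]
  rw [← ENNReal.ofReal_prod_of_nonneg fun (x : A) _ => div_nonneg (h.siteWeight_pos hφ x _).le
    (h.siteZ_pos hφ (hs x x.2)).le, Finset.prod_div_distrib,
    Finset.prod_coe_sort A fun x => siteZ w lam φ x]

theorem configWeight_pos (A : Finset ℕ) (η : A → ℕ) : 0 < configWeight w lam A η :=
  Finset.prod_pos fun x _ => mul_pos (h.w_pos x _) (pow_pos (h.lam_pos x) _)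

theorem isProbabilityMeasure_canonical {A : Finset ℕ} {N : ℕ} (hZ : 0 < canonicalZ w lam A N) :
    IsProbabilityMeasure (canonical w lam A N) := by
  constructor
  rw [canonical, Measure.finsetSum_apply]
  simp only [Measure.smul_apply, measure_univ, smul_eq_mul, mul_one]
  rw [← ENNReal.ofReal_sum_of_nonneg fun η _ => div_nonneg (h.configWeight_pos A η).le hZ.le,
    ← Finset.sum_div]
  change ENNReal.ofReal (canonicalZ w lam A N / canonicalZ w lam A N) = 1
  rw [div_self hZ.ne', ENNReal.ofReal_one]

/-- The total weight of the configurations on `A` with `N` particles extending a given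
configuration on `B ⊆ A`. -/
theorem sum_configWeight_le {φ r K : ℝ} (hφ : 0 < φ) (hr : 0 < r) (hr1 : r ≤ 1)
    (hK : HasSum (fun n => whi n * r ^ n) K) {A B : Finset ℕ} (hBA : B ⊆ A)
    (hlam : ∀ x, lam x * φ ≤ 1) (N : ℕ) (η : B → ℕ) :
    (∑ ζ ∈ (Finset.piAntidiag (Finset.univ : Finset A) N).filter
        (fun ζ => Finset.restrict₂ (π := fun _ => ℕ) hBA ζ = η), configWeight w lam A ζ) *
        (φ ^ N * r ^ N) ≤
      (∏ x : B, siteWeight w lam φ x (η x)) * K ^ (A \ B).card := by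
  classical
  set t : A → Finset ℕ := fun x => if hx : (x : ℕ) ∈ B then {η ⟨x, hx⟩}
    else Finset.range (N + 1) with ht
  -- Conservation of particles distributes φ^N r^N over the sites. The factor r^n makes the sums off
  -- B bounded even where z_x(φ) diverges; on B it is discarded.
  set g : A → ℕ → ℝ := fun x n => siteWeight w lam φ x n * r ^ n with hg
  have hg0 : ∀ x n, 0 ≤ g x n := fun x n =>
    mul_nonneg (h.siteWeight_pos hφ x n).le (pow_nonneg hr.le n)
  set F : ℕ → ℝ := fun x => if hx : x ∈ B then siteWeight w lam φ x (η ⟨x, hx⟩) else K with hF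
  have h1 : (∑ ζ ∈ (Finset.piAntidiag (Finset.univ : Finset A) N).filter
        (fun ζ => Finset.restrict₂ (π := fun _ => ℕ) hBA ζ = η), configWeight w lam A ζ) *
        (φ ^ N * r ^ N) ≤ ∑ ζ ∈ Fintype.piFinset t, ∏ x, g x (ζ x) := by
    have hsum : ∀ ζ ∈ Finset.piAntidiag (Finset.univ : Finset A) N, ∑ x, ζ x = N :=
      fun ζ hζ => (Finset.mem_piAntidiag.1 hζ).1
    have heq : ∀ ζ ∈ (Finset.piAntidiag (Finset.univ : Finset A) N).filter
        (fun ζ => Finset.restrict₂ (π := fun _ => ℕ) hBA ζ = η),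
        configWeight w lam A ζ * (φ ^ N * r ^ N) = ∏ x, g x (ζ x) := by
      intro ζ hζ
      rw [← hsum ζ (Finset.mem_filter.1 hζ).1, ← Finset.prod_pow_eq_pow_sum,
        ← Finset.prod_pow_eq_pow_sum, configWeight, ← Finset.prod_mul_distrib,
        ← Finset.prod_mul_distrib]
      refine Finset.prod_congr rfl fun x _ => ?_
      simp only [hg, siteWeight, mul_pow]
      ring
    have hsub : (Finset.piAntidiag (Finset.univ : Finset A) N).filter
        (fun ζ => Finset.restrict₂ (π := fun _ => ℕ) hBA ζ = η) ⊆ Fintype.piFinset t := by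
      intro ζ hζ
      obtain ⟨hζ1, hζ2⟩ := Finset.mem_filter.1 hζ
      rw [Fintype.mem_piFinset]
      intro x
      by_cases hx : (x : ℕ) ∈ B
      · have : ζ x = η ⟨x, hx⟩ := congrFun hζ2 ⟨x, hx⟩
        simp [ht, hx, this]
      · have : ζ x ≤ N := hsum ζ hζ1 ▸ Finset.single_le_sum (fun y _ => Nat.zero_le (ζ y))
          (Finset.mem_univ x)
        simp only [ht, hx, dif_neg, not_false_eq_true, Finset.mem_range]
        omega
    rw [Finset.sum_mul, Finset.sum_congr rfl heq]
    exact Finset.sum_le_sum_of_subset_of_nonneg hsub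
      fun ζ _ _ => Finset.prod_nonneg fun x _ => hg0 _ _
  refine h1.trans ?_
  rw [← Finset.prod_univ_sum]
  have h2 : ∏ x : A, ∑ n ∈ t x, g x n ≤ ∏ x : A, F x := by
    refine Finset.prod_le_prod (fun x _ => Finset.sum_nonneg fun n _ => hg0 x n) fun x _ => ?_
    by_cases hx : (x : ℕ) ∈ B
    · simp only [ht, hF, hx, dif_pos, Finset.sum_singleton, hg]
      exact mul_le_of_le_one_right (h.siteWeight_pos hφ x _).le (pow_le_one₀ hr.le hr1)
    · simp only [ht, hF, hx, dif_neg, not_false_eq_true]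
      refine (Finset.sum_le_sum fun n _ => ?_).trans
        (sum_le_hasSum (Finset.range (N + 1)) (fun n _ => ?_) hK)
      · have := h.siteWeight_le hφ (hlam x) n
        rw [one_pow, mul_one] at this
        simp only [hg]
        gcongr
      · have := h.whi_pos n
        positivity
  refine h2.trans (le_of_eq ?_)
  rw [Finset.prod_coe_sort A F, ← Finset.prod_sdiff hBA, mul_comm, ← Finset.prod_coe_sort B F]
  congr 1
  · exact Finset.prod_congr rfl fun x _ => by simp [hF]
  · exact Finset.prod_eq_pow_card fun x hx => by simp [hF, (Finset.mem_sdiff.1 hx).2]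

/-- On a countable space domination is checked on points, where the weights on B cancel and only
`hk` remains. -/
theorem map_canonical_le {φ r K : ℝ} (hφ : 0 < φ) (hr : 0 < r) (hr1 : r ≤ 1)
    (hK : HasSum (fun n => whi n * r ^ n) K) {A B : Finset ℕ} (hBA : B ⊆ A)
    (hlam : ∀ x, lam x * φ ≤ 1)
    (hs : ∀ x ∈ B, Summable fun n => siteWeight w lam φ x n) {N : ℕ}
    (hZ : 0 < canonicalZ w lam A N) {k : ℝ}
    (hk : (∏ x ∈ B, siteZ w lam φ x) * K ^ (A \ B).card ≤
      k * (r ^ N * (φ ^ N * canonicalZ w lam A N))) :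
    (canonical w lam A N).map (Finset.restrict₂ (π := fun _ => ℕ) hBA) ≤
      ENNReal.ofReal k • grandCanonical w lam φ B := by
  classical
  refine measure_le_of_singleton_le fun η => ?_
  have hzB : 0 < ∏ x ∈ B, siteZ w lam φ x :=
    Finset.prod_pos fun x hx => h.siteZ_pos hφ (hs x hx)
  have hW : 0 ≤ ∏ x : B, siteWeight w lam φ x (η x) :=
    Finset.prod_nonneg fun x _ => (h.siteWeight_pos hφ x _).le
  have hK0 : 0 ≤ K := hK.nonneg fun n => by have := h.whi_pos n; positivity
  have hk0 : 0 ≤ k := by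
    have h1 : 0 ≤ k * (r ^ N * (φ ^ N * canonicalZ w lam A N)) :=
      le_trans (by positivity) hk
    exact nonneg_of_mul_nonneg_left h1 (by positivity)
  rw [Measure.map_apply (Measurable.of_discrete) (measurableSet_singleton η), Measure.smul_apply,
    smul_eq_mul, h.grandCanonical_singleton hφ hs, ← ENNReal.ofReal_mul hk0, canonical,
    Measure.finsetSum_apply]
  have e : ∀ ζ : A → ℕ, (ENNReal.ofReal (configWeight w lam A ζ / canonicalZ w lam A N) •
      Measure.dirac ζ) (Finset.restrict₂ (π := fun _ => ℕ) hBA ⁻¹' {η}) =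
      if Finset.restrict₂ (π := fun _ => ℕ) hBA ζ = η then
        ENNReal.ofReal (configWeight w lam A ζ / canonicalZ w lam A N) else 0 := by
    intro ζ
    rw [Measure.smul_apply, Measure.dirac_apply, smul_eq_mul]
    by_cases hζ : Finset.restrict₂ (π := fun _ => ℕ) hBA ζ = η
    · simp [hζ]
    · simp [hζ]
  simp only [e]
  rw [← Finset.sum_filter,
    ← ENNReal.ofReal_sum_of_nonneg fun ζ _ => div_nonneg (h.configWeight_pos A ζ).le hZ.le,
    ← Finset.sum_div]
  refine ENNReal.ofReal_le_ofReal ?_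
  have key := h.sum_configWeight_le hφ hr hr1 hK hBA hlam N η
  set Q := ∑ ζ ∈ (Finset.piAntidiag (Finset.univ : Finset A) N).filter
        (fun ζ => Finset.restrict₂ (π := fun _ => ℕ) hBA ζ = η), configWeight w lam A ζ
  set W := ∏ x : B, siteWeight w lam φ x (η x)
  set zB := ∏ x ∈ B, siteZ w lam φ x
  rw [mul_div_assoc', div_le_div_iff₀ hZ hzB]
  have hp : 0 < φ ^ N * r ^ N := by positivity
  refine le_of_mul_le_mul_right ?_ hp
  calc Q * zB * (φ ^ N * r ^ N) = Q * (φ ^ N * r ^ N) * zB := by ring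
    _ ≤ W * K ^ (A \ B).card * zB := by gcongr
    _ = W * (zB * K ^ (A \ B).card) := by ring
    _ ≤ W * (k * (r ^ N * (φ ^ N * canonicalZ w lam A N))) := by gcongr
    _ = _ := by ring

/-! ### The relative entropy per site. -/

section Domain

variable (hD : Set.Ico 0 (critFugacity lam) ⊆ densityDomain w lam)
  {ρc : ℝ} (hρc : Tendsto (limitDensity w lam) (𝓝[<] (critFugacity lam)) (𝓝 ρc))
include hD hρc

/-- The relative entropy of the marginal on `B L` is eventually bounded by an expression of
order `o(L) + O(η) * L`. -/
theorem exists_eventually_klDiv_le {ρ : ℝ} (hρ : ρc ≤ ρ) {N : ℕ → ℕ}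
    (hN : Tendsto (fun L : ℕ => (N L : ℝ) / L) atTop (𝓝 ρ)) {B : ℕ → Finset ℕ}
    (hB : ∀ L, B L ⊆ Finset.range L)
    (hs : ∀ L, ∀ x ∈ B L, Summable fun n => siteWeight w lam (critFugacity lam) x n)
    (hS : ∀ L, ∀ x ∈ B L, Summable fun n : ℕ => n * siteWeight w lam (critFugacity lam) x n)
    {M : ℝ} (hM : ∀ᶠ L : ℕ in atTop,
      ∑ x ∈ B L, siteDensity w lam (critFugacity lam) x ≤ M * L)
    {η : ℝ} (hη : 0 < η) :
    ∃ a b : ℝ, ∀ᶠ L : ℕ in atTop,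
      InformationTheory.klDiv
        ((canonical w lam (Finset.range L) (N L)).map
          (Finset.restrict₂ (π := fun _ => ℕ) (hB L)))
        (grandCanonical w lam (critFugacity lam) (B L)) ≤
      ENNReal.ofReal (a + b * (Finset.range L \ B L).card + 3 * η * N L + η * L) := by
  classical
  have hc0 := h.critFugacity_pos
  set φ := critFugacity lam
  set r := Real.exp (-η) with hrdef
  have hr : 0 < r := Real.exp_pos _
  have hr1 : r < 1 := by rw [← Real.exp_zero]; exact Real.exp_lt_exp.2 (by linarith)
  obtain ⟨c, hc, hcr⟩ := exists_mul_geometric_le h.wlo_pos h.tendsto_wlo hr hr1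
  obtain ⟨y, hy⟩ := h.exists_le_lam_mul_critFugacity hr hr1
  have hKs := (summable_mul_geometric h.whi_pos h.tendsto_whi hr hr1).hasSum
  set K := ∑' n, whi n * r ^ n
  have hK0 : 0 < K := by
    have h1 := le_hasSum hKs 0 fun n _ => by have := h.whi_pos n; positivity
    have := h.whi_pos 0
    rw [pow_zero, mul_one] at h1
    linarith
  set d := min 1 (wlo 0) with hd
  have hd0 : 0 < d := lt_min one_pos (h.wlo_pos 0)
  -- Accounts for y when it lies in B. If y is a trap with divergent partition function, `siteZ` is
  -- 0 by default and the maximum with 1 still serves.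
  set m := max 1 (siteZ w lam φ y) with hm
  have hm0 : 0 < m := lt_max_of_lt_left one_pos
  refine ⟨Real.log (m / c), Real.log (K / d), ?_⟩
  filter_upwards [h.eventually_exp_mul_prod_siteZ_le_partialZ_critFugacity hD hρc hρ hN hB hs hS hM
    hη, eventually_gt_atTop y] with L hL hyL
  -- The site y is reserved for the surplus, so it must be separated from the sites in the
  -- restricted partition function.
  set A := (B L).erase y with hA
  set T := Finset.range L \ B L with hT
  have hAB : A ⊆ B L := Finset.erase_subset _ _
  have hG := hL A hAB
  have hlow := h.canonicalZ_lower hc0 hr hr1.le hc hcr (hAB.trans (hB L))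
    (Finset.mem_range.2 hyL) (Finset.notMem_erase y _) hy (N L)
  set Z := canonicalZ w lam (Finset.range L) (N L)
  set zA := ∏ x ∈ A, siteZ w lam φ x with hzA
  have hzA0 : 0 < zA := Finset.prod_pos fun x hx => h.siteZ_pos hc0 (hs L x (hAB hx))
  have hd_pow : d ^ T.card ≤ ∏ x ∈ (Finset.range L \ A).erase y, w x 0 := by
    have hsub : (Finset.range L \ A).erase y ⊆ T := by
      intro x
      simp only [hA, hT, Finset.mem_erase, Finset.mem_sdiff]
      tauto
    calc d ^ T.card ≤ d ^ ((Finset.range L \ A).erase y).card :=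
          pow_le_pow_of_le_one hd0.le (min_le_left _ _) (Finset.card_le_card hsub)
      _ ≤ _ := by
          rw [← Finset.prod_const]
          exact Finset.prod_le_prod (fun _ _ => hd0.le) fun x _ =>
            (min_le_right _ _).trans (h.wlo_le x 0)
  have hlow2 : d ^ T.card * (c * (r * r) ^ N L) * (Real.exp (-(η * L)) * zA) ≤ φ ^ N L * Z := by
    refine le_trans ?_ hlow
    have : 0 ≤ ∏ x ∈ (Finset.range L \ A).erase y, w x 0 :=
      Finset.prod_nonneg fun x _ => (h.w_pos x 0).le
    gcongr
  have hZ : 0 < Z := by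
    have : 0 < φ ^ N L * Z := lt_of_lt_of_le (by positivity) hlow2
    exact pos_of_mul_pos_right this (by positivity)
  have hzB : ∏ x ∈ B L, siteZ w lam φ x ≤ zA * m := by
    by_cases hyB : y ∈ B L
    · rw [← Finset.prod_erase_mul _ _ hyB]
      exact mul_le_mul_of_nonneg_left (le_max_right _ _) hzA0.le
    · rw [hzA, hA, Finset.erase_eq_of_notMem hyB]
      refine le_mul_of_one_le_right ?_ (le_max_left _ _)
      exact Finset.prod_nonneg fun x hx => (h.siteZ_pos hc0 (hs L x hx)).le
  set E := Real.log (m / c) + Real.log (K / d) * T.card + 3 * η * N L + η * L with hE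
  have hexp : Real.exp E * (r ^ N L * (d ^ T.card * (c * (r * r) ^ N L) *
      (Real.exp (-(η * L)) * zA))) = zA * m * K ^ T.card := by
    have e1 : Real.exp E = m / c * (K / d) ^ T.card * Real.exp (3 * η * N L) *
        Real.exp (η * L) := by
      rw [hE, Real.exp_add, Real.exp_add, Real.exp_add, Real.exp_log (by positivity),
        mul_comm (Real.log (K / d)), Real.exp_nat_mul, Real.exp_log (by positivity)]
    -- The 3 counts one r^N from the upper bound and two from the lower bound.
    have e2 : Real.exp (3 * η * N L) * (r ^ N L * (r * r) ^ N L) = 1 := by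
      rw [← mul_pow, hrdef, ← Real.exp_add, ← Real.exp_add, ← Real.exp_nat_mul, ← Real.exp_add,
        ← Real.exp_zero]
      congr 1; ring
    have e3 : Real.exp (η * L) * Real.exp (-(η * L)) = 1 := by rw [← Real.exp_add]; simp
    calc _ = m / c * c * ((K / d) ^ T.card * d ^ T.card) *
          (Real.exp (3 * η * N L) * (r ^ N L * (r * r) ^ N L)) *
          (Real.exp (η * L) * Real.exp (-(η * L))) * zA := by rw [e1]; ring
      _ = _ := by
          rw [e2, e3, ← mul_pow, div_mul_cancel₀ _ hc.ne', div_mul_cancel₀ _ hd0.ne']; ring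
  have hle := h.map_canonical_le hc0 hr hr1.le hKs (hB L) h.lam_mul_critFugacity_le (hs L) hZ
    (k := Real.exp E) (by
      calc _ ≤ zA * m * K ^ T.card := by gcongr
        _ = _ := hexp.symm
        _ ≤ _ := by gcongr)
  have := h.isProbabilityMeasure_canonical hZ
  have := h.isProbabilityMeasure_grandCanonical hc0 (hs L)
  have : IsProbabilityMeasure ((canonical w lam (Finset.range L) (N L)).map
      (Finset.restrict₂ (π := fun _ => ℕ) (hB L))) :=
    Measure.isProbabilityMeasure_map (Measurable.of_discrete).aemeasurable
  have := klDiv_le_log_of_le_smul (Real.exp_pos E) hle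
  rwa [Real.log_exp] at this

theorem tendsto_klDiv_div {ρ : ℝ} (hρ : ρc ≤ ρ) {N : ℕ → ℕ}
    (hN : Tendsto (fun L : ℕ => (N L : ℝ) / L) atTop (𝓝 ρ)) {B : ℕ → Finset ℕ}
    (hB : ∀ L, B L ⊆ Finset.range L)
    (hs : ∀ L, ∀ x ∈ B L, Summable fun n => siteWeight w lam (critFugacity lam) x n)
    (hS : ∀ L, ∀ x ∈ B L, Summable fun n : ℕ => n * siteWeight w lam (critFugacity lam) x n)
    {M : ℝ} (hM : ∀ᶠ L : ℕ in atTop,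
      ∑ x ∈ B L, siteDensity w lam (critFugacity lam) x ≤ M * L)
    (hT : Tendsto (fun L : ℕ => ((Finset.range L \ B L).card : ℝ) / L) atTop (𝓝 0)) :
    Tendsto (fun L : ℕ => InformationTheory.klDiv
        ((canonical w lam (Finset.range L) (N L)).map
          (Finset.restrict₂ (π := fun _ => ℕ) (hB L)))
        (grandCanonical w lam (critFugacity lam) (B L)) / (L : ENNReal)) atTop (𝓝 0) := by
  rw [ENNReal.tendsto_nhds_zero]
  intro ε hε
  obtain ⟨e, he, heε⟩ := ENNReal.lt_iff_exists_real_btwn.1 hε |>.imp fun e he => he.2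
  have he0 : 0 < e := by simpa using he
  have hρ0 : 0 ≤ ρ := ge_of_tendsto' hN fun L => by positivity
  -- Makes the limiting bound 3ηρ + η equal to e/2.
  set η := e / (2 * (3 * ρ + 1)) with hη
  have hη0 : 0 < η := by positivity
  obtain ⟨a, b, hab⟩ := h.exists_eventually_klDiv_le hD hρc hρ hN hB hs hS hM hη0
  have hlim : Tendsto (fun L : ℕ => a / (L : ℝ) + b * (((Finset.range L \ B L).card : ℝ) / L) +
      3 * η * ((N L : ℝ) / L) + η) atTop (𝓝 (0 + b * 0 + 3 * η * ρ + η)) :=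
    (((tendsto_const_div_atTop_nhds_zero_nat a).add (hT.const_mul b)).add
      (hN.const_mul (3 * η))).add_const η
  have hlt : 0 + b * 0 + 3 * η * ρ + η < e := by
    have : η * (3 * ρ + 1) = e / 2 := by rw [hη]; field_simp
    nlinarith
  filter_upwards [hab, hlim.eventually (gt_mem_nhds hlt), eventually_gt_atTop 0] with L h1 h2 hL
  have hL' : (0 : ℝ) < L := by exact_mod_cast hL
  refine le_trans ?_ heε.le
  refine ENNReal.div_le_of_le_mul (h1.trans ?_)
  rw [← ENNReal.ofReal_natCast, ← ENNReal.ofReal_mul he0.le]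
  refine ENNReal.ofReal_le_ofReal ?_
  have e1 : a + b * (Finset.range L \ B L).card + 3 * η * N L + η * L =
      (a / (L : ℝ) + b * (((Finset.range L \ B L).card : ℝ) / L) +
      3 * η * ((N L : ℝ) / L) + η) * L := by field_simp
  rw [e1]
  gcongr

end Domain

/-! ### Trap sites have density zero in the lattice. -/

section Trap

omit h in
theorem lam_mul_of_mem_trapSites {x : ℕ} (hx : x ∈ trapSites lam) (φ : ℝ) :
    lam x * φ = φ / critFugacity lam := by
  have : lam x = 1 / critFugacity lam := hx
  rw [this]; ring

/-- If the first moment of the lower weights diverges, the density at the trap sites diverges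
uniformly as the fugacity approaches its critical value. -/
theorem eventually_le_siteDensity_trapSites (hdiv : ¬ Summable fun n : ℕ => (n : ℝ) * wlo n)
    (M : ℝ) : ∀ᶠ φ in 𝓝[<] (critFugacity lam), ∀ x ∈ trapSites lam,
      M ≤ siteDensity w lam φ x := by
  have hc0 := h.critFugacity_pos
  -- Split z_x at k: the head is at most W, and the tail at most S/k, where S is the first moment.
  -- With k ≥ 2M and S ≥ 2WM each part contributes at most S/2 to M z_x.
  obtain ⟨k, hk⟩ := exists_nat_ge (2 * M)
  set W := ∑ n ∈ Finset.range k, whi n with hW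
  have hW0 : 0 ≤ W := Finset.sum_nonneg fun n _ => (h.whi_pos n).le
  obtain ⟨J, hJ⟩ : ∃ J : ℕ, 2 * W * M < ∑ n ∈ Finset.range J, (n : ℝ) * wlo n := by
    by_contra hcon
    push Not at hcon
    exact hdiv (summable_of_sum_range_le
      (fun n => mul_nonneg n.cast_nonneg (h.wlo_pos n).le) hcon)
  have hcont : Tendsto (fun φ : ℝ => ∑ n ∈ Finset.range J,
      (n : ℝ) * (wlo n * (φ / critFugacity lam) ^ n)) (𝓝[<] (critFugacity lam))
      (𝓝 (∑ n ∈ Finset.range J, (n : ℝ) * wlo n)) := by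
    have hc : Continuous fun φ : ℝ => ∑ n ∈ Finset.range J,
      (n : ℝ) * (wlo n * (φ / critFugacity lam) ^ n) := by fun_prop
    have := (hc.tendsto (critFugacity lam)).mono_left
      (nhdsWithin_le_nhds (s := Set.Iio (critFugacity lam)))
    simpa [div_self hc0.ne'] using this
  filter_upwards [hcont.eventually (lt_mem_nhds hJ), Ioo_mem_nhdsLT hc0] with φ hφJ hφ x hx
  obtain ⟨hφ0, hφc⟩ := hφ
  have ht := lam_mul_of_mem_trapSites hx φ
  set t := φ / critFugacity lam with htdef
  have ht0 : 0 < t := by positivity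
  have ht1 : t < 1 := (div_lt_one hc0).2 hφc
  have hs := h.summable_siteWeight hφ0 ht1 ht.le
  have hS := h.summable_mul_siteWeight hφ0 ht1 ht.le
  have hsw := fun n => (h.siteWeight_pos hφ0 x n).le
  have hz := h.siteZ_pos hφ0 hs
  rw [siteDensity, le_div_iff₀ hz]
  set S := ∑' n : ℕ, n * siteWeight w lam φ x n
  have hSJ : 2 * W * M ≤ S := by
    refine hφJ.le.trans (le_trans (Finset.sum_le_sum fun n _ => ?_)
      (hS.sum_le_tsum (Finset.range J) fun n _ => mul_nonneg n.cast_nonneg (hsw n)))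
    rw [siteWeight, ht]
    have := h.wlo_le x n
    gcongr
  have hsplit : siteZ w lam φ x ≤ W + ∑' n, siteWeight w lam φ x (n + k) := by
    rw [siteZ, ← hs.sum_add_tsum_nat_add k]
    refine add_le_add_left (Finset.sum_le_sum fun n _ => ?_) _
    have := h.siteWeight_le hφ0 ht.le n
    refine this.trans (mul_le_of_le_one_right (h.whi_pos n).le (pow_le_one₀ ht0.le ht1.le))
  have htail : k * ∑' n, siteWeight w lam φ x (n + k) ≤ S := by
    have hs' : Summable fun n => siteWeight w lam φ x (n + k) := (summable_nat_add_iff k).2 hs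
    have hS' : Summable fun n : ℕ => ((n + k : ℕ) : ℝ) * siteWeight w lam φ x (n + k) :=
      (summable_nat_add_iff k (f := fun n : ℕ => (n : ℝ) * siteWeight w lam φ x n)).2 hS
    rw [← tsum_mul_left]
    refine ((hs'.mul_left _).tsum_le_tsum (fun n => ?_) hS').trans ?_
    · have := hsw (n + k)
      gcongr
      omega
    · have := hS.sum_add_tsum_nat_add k
      have h0 : 0 ≤ ∑ n ∈ Finset.range k, (n : ℝ) * siteWeight w lam φ x n :=
        Finset.sum_nonneg fun n _ => mul_nonneg n.cast_nonneg (hsw n)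
      linarith
  have hS0 : 0 ≤ S := tsum_nonneg fun n => mul_nonneg n.cast_nonneg (hsw n)
  rcases le_or_gt M 0 with hM | hM
  · nlinarith
  · have htl : 0 ≤ ∑' n, siteWeight w lam φ x (n + k) := tsum_nonneg fun n => hsw (n + k)
    nlinarith

/-- Trap sites of density at least M can fill at most a fraction of order 1/M of the lattice, since
the total density at some fixed φ < φ_c is bounded in terms of ρ_c alone. -/
theorem tendsto_card_trapPart_div (hD : Set.Ico 0 (critFugacity lam) ⊆ densityDomain w lam)
    {ρc : ℝ} (hρc : Tendsto (limitDensity w lam) (𝓝[<] (critFugacity lam)) (𝓝 ρc))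
    (hdiv : ¬ Summable fun n : ℕ => (n : ℝ) * wlo n) :
    Tendsto (fun L : ℕ => ((trapPart lam L).card : ℝ) / L) atTop (𝓝 0) := by
  have hc0 := h.critFugacity_pos
  refine Metric.tendsto_atTop.2 fun ε hε => eventually_atTop.1 ?_
  have hM0 : 0 < (|ρc| + 2) / ε := by positivity
  obtain ⟨φ, hM, hlim, hφ0, hφc⟩ := ((h.eventually_le_siteDensity_trapSites hdiv
    ((|ρc| + 2) / ε)).and ((hρc.eventually (gt_mem_nhds (show ρc < |ρc| + 1 by
      linarith [le_abs_self ρc]))).and (Ioo_mem_nhdsLT hc0))).exists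
  have hR := tendsto_avgDensity (hD ⟨hφ0.le, hφc⟩)
  filter_upwards [hR.eventually (gt_mem_nhds (show limitDensity w lam φ < |ρc| + 2 by linarith)),
    eventually_gt_atTop 0] with L h1 hL
  have hL' : (0 : ℝ) < L := by exact_mod_cast hL
  rw [Real.dist_eq, sub_zero, abs_of_nonneg (by positivity), div_lt_iff₀ hL']
  have h2 := h.sum_siteDensity_le hφ0 (trapPart_subset lam L)
  have h3 : ((trapPart lam L).card : ℝ) * ((|ρc| + 2) / ε) ≤
      ∑ x ∈ trapPart lam L, siteDensity w lam φ x := by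
    rw [← nsmul_eq_mul]
    exact Finset.card_nsmul_le_sum _ _ _ fun x hx => hM x (mem_trapPart.1 hx).2
  have h4 : ((trapPart lam L).card : ℝ) * ((|ρc| + 2) / ε) < (|ρc| + 2) * L :=
    (h3.trans h2).trans_lt (mul_lt_mul_of_pos_right h1 hL')
  rw [mul_div_assoc', div_lt_iff₀ hε] at h4
  have : 0 < |ρc| + 2 := by positivity
  nlinarith

end Trap

end Regular

end Condensation

/-! ### The two cases. -/

theorem mainTheorem2
    (w : ℕ → ℕ → ℝ) (wlo whi lam : ℕ → ℝ) (C ρc : ℝ)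
    (hwlo_pos : ∀ n, 0 < wlo n)
    (hw : ∀ x n, wlo n ≤ w x n ∧ w x n ≤ whi n)
    (hwlo : Tendsto (fun n => wlo (n + 1) / wlo n) atTop (𝓝 1))
    (hwhi : Tendsto (fun n => whi (n + 1) / whi n) atTop (𝓝 1))
    (hdiv : ¬ Summable fun n : ℕ => (n : ℝ) * wlo n)
    (hlam : ∀ x, 0 < lam x ∧ lam x ≤ C)
    (hD : Set.Ico 0 (Condensation.critFugacity lam) ⊆ Condensation.densityDomain w lam)
    (hρc : Tendsto (Condensation.limitDensity w lam)
      (𝓝[<] (Condensation.critFugacity lam)) (𝓝 ρc)) :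
    -- the delocalized case
    ((∀ x, lam x < 1 / Condensation.critFugacity lam) →
      Condensation.critFugacity lam ∈ Condensation.densityDomain w lam →
      (∀ x, Integrable (fun n : ℕ => (n : ℝ) ^ 2)
        (Condensation.siteMeasure w lam (Condensation.critFugacity lam) x)) →
      ∀ ρ : ℝ, ρc ≤ ρ → ∀ N : ℕ → ℕ,
        Tendsto (fun L : ℕ => (N L : ℝ) / L) atTop (𝓝 ρ) →
        Tendsto (fun L : ℕ =>
          InformationTheory.klDiv
            (Condensation.canonical w lam (Finset.range L) (N L))
            (Condensation.grandCanonical w lam (Condensation.critFugacity lam)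
              (Finset.range L)) / (L : ENNReal)) atTop (𝓝 0)) ∧
    -- the localized case
    ((Condensation.trapSites lam).Nonempty →
      (∃ δ : ℝ, 0 < δ ∧ ∀ y, y ∉ Condensation.trapSites lam →
        Condensation.critFugacity lam + δ < 1 / lam y) →
      (∀ ρ : ℝ, ρc ≤ ρ → ∀ N : ℕ → ℕ,
        Tendsto (fun L : ℕ => (N L : ℝ) / L) atTop (𝓝 ρ) →
        Tendsto (fun L : ℕ =>
          InformationTheory.klDiv
            (Condensation.canonicalBulk w lam L (N L))
            (Condensation.grandCanonical w lam (Condensation.critFugacity lam)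
              (Condensation.bulkPart lam L)) / (L : ENNReal)) atTop (𝓝 0)) ∧
      Tendsto (fun L : ℕ => ((Condensation.trapPart lam L).card : ℝ) / L) atTop (𝓝 0)) := by
  have h : Condensation.Regular w wlo whi lam C :=
    ⟨hwlo_pos, fun x n => (hw x n).1, fun x n => (hw x n).2, hwlo, hwhi, fun x => (hlam x).1,
      fun x => (hlam x).2⟩
  have hc0 := h.critFugacity_pos
  refine ⟨fun _ hcD _ ρ hρ N hN => ?_, fun _ hδ => ?_⟩
  · obtain ⟨R, hR⟩ := hcD.2.2.2
    have key := h.tendsto_klDiv_div hD hρc hρ hN (B := Finset.range) (fun L => subset_rfl)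
      (fun L x _ => hcD.2.1 x) (fun L x _ => hcD.2.2.1 x) (M := R + 1) (by
        filter_upwards [hR.eventually (gt_mem_nhds (show R < R + 1 by linarith))] with L hL
        refine (h.sum_siteDensity_le hc0 subset_rfl).trans ?_
        gcongr) (by simp)
    -- With B the whole lattice, restriction is the identity.
    refine key.congr fun L => ?_
    congr 2
    exact Measure.map_id
  · have hcard := h.tendsto_card_trapPart_div hD hρc hdiv
    refine ⟨fun ρ hρ N hN => ?_, hcard⟩
    obtain ⟨δ, hδ, hgap⟩ := hδ
    set φ := Condensation.critFugacity lam
    have hr1 : φ / (φ + δ) < 1 := (div_lt_one (by linarith)).2 (by linarith)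
    -- The gap δ keeps bulk sites uniformly subcritical at φ_c, so their partition functions
    -- converge and their densities are uniformly bounded.
    have hr : ∀ L, ∀ x ∈ Condensation.bulkPart lam L, lam x * φ ≤ φ / (φ + δ) := by
      intro L x hx
      have hxt : x ∉ Condensation.trapSites lam := by
        intro hxt
        obtain ⟨hx1, hx2⟩ := Finset.mem_sdiff.1 hx
        exact hx2 (Condensation.mem_trapPart.2 ⟨hx1, hxt⟩)
      have := hgap x hxt
      rw [lt_div_iff₀ (h.lam_pos x)] at this
      rw [le_div_iff₀ (by linarith)]
      nlinarith
    refine h.tendsto_klDiv_div hD hρc hρ hN (Condensation.bulkPart_subset lam)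
      (fun L x hx => h.summable_siteWeight hc0 hr1 (hr L x hx))
      (fun L x hx => h.summable_mul_siteWeight hc0 hr1 (hr L x hx))
      (M := (∑' n : ℕ, ((n : ℝ) + 1) * (whi n * (φ / (φ + δ)) ^ n)) / wlo 0)
      (Eventually.of_forall fun L => ?_) (hcard.congr fun L => ?_)
    · have hle := Finset.sum_le_card_nsmul (Condensation.bulkPart lam L) _ _
        fun x hx => h.siteDensity_le hc0 hr1 (hr L x hx)
      rw [nsmul_eq_mul] at hle
      have hcL : ((Condensation.bulkPart lam L).card : ℝ) ≤ L := by
        exact_mod_cast (Finset.card_le_card (Condensation.bulkPart_subset lam L)).trans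
          (Finset.card_range L).le
      have h0 : 0 ≤ (∑' n : ℕ, ((n : ℝ) + 1) * (whi n * (φ / (φ + δ)) ^ n)) / wlo 0 :=
        div_nonneg (tsum_nonneg fun n => by
          have := h.whi_pos n
          positivity) (h.wlo_pos 0).le
      rw [mul_comm] at hle
      exact hle.trans (mul_le_mul_of_nonneg_left hcL h0)
    · rw [Condensation.bulkPart, Finset.sdiff_sdiff_eq_self (Condensation.trapPart_subset lam L)]
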